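/- Let $\widetilde M$ be a Kähler manifold with Riemannian metric $g$, complex structure $J$ and Levi-Civita connection $\widetilde\nabla$, and let $M$ be a connected smooth surface (a submanifold of real dimension $2$, possibly only immersed) in $\widetilde M$, with the induced metric. Write $\nabla$ for the Levi-Civita connection of $M$, $\sigma$ for its second fundamental form, defined by $\widetilde\nabla_XY=\nabla_XY+\sigma(X,Y)$ for tangent vector fields $X,Y$ of $M$, and $H=\frac12\operatorname{tr}\sigma$ for its mean curvature vector. For a normal vector field $\xi$ let $-A_\xi X$ and $D_X\xi$ be the tangential and the normal component of $\widetilde\nabla_X\xi$, and let $f\xi$ be the normal component of $J\xi$. Suppose that - $M$ is totally real: $J\,T_pM\subset T_pM^\perp$ for every $p\in M$; - $M$ has commutative second fundamental forms: $A_\xi A_\eta=A_\eta A_\xi$ for all normal vector fields $\xi,\eta$; - the $f$-structure in the normal bundle is parallel: $D_X(f\xi)=f(D_X\xi)$ for all tangent vector fields $X$ and normal vector fields $\xi$ (this holds trivially if $f=0$); - the mean curvature vector is parallel: $D_XH=0$ for all tangent vector fields $X$. Then $M$ is flat (the curvature tensor of $\nabla$ vanishes identically) or totally geodesic ($\sigma=0$).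 -/

import Mathlib

open Bundle FiberBundle VectorField
open scoped Manifold ContDiff

namespace TotReal

noncomputable section

/-! ### The Levi-Civita connection of a Riemannian manifold -/

section LeviCivita

variable {E : Type*} [NormedAddCommGroup E] [NormedSpace ℝ E]
  {M : Type*} [TopologicalSpace M] [ChartedSpace E M]

instance tangentSpace_finiteDimensional [FiniteDimensional ℝ E] (x : M) :
    FiniteDimensional ℝ (TangentSpace 𝓘(ℝ, E) x) :=
  inferInstanceAs (FiniteDimensional ℝ E)

variable [RiemannianBundle (fun x : M ↦ TangentSpace 𝓘(ℝ, E) x)]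

instance tangentSpace_completeSpace [FiniteDimensional ℝ E] (x : M) :
    CompleteSpace (TangentSpace 𝓘(ℝ, E) x) :=
  FiniteDimensional.complete ℝ _

/-- The Koszul expression
`X⟨Y, Z⟩ + Y⟨X, Z⟩ - Z⟨X, Y⟩ + ⟨[X, Y], Z⟩ - ⟨[X, Z], Y⟩ - ⟨[Y, Z], X⟩` at the point `x`. -/
def koszul (X Y Z : Π x : M, TangentSpace 𝓘(ℝ, E) x) (x : M) : ℝ :=
  mvfderiv 𝓘(ℝ, E) (fun y ↦ inner ℝ (Y y) (Z y)) x (X x)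
  + mvfderiv 𝓘(ℝ, E) (fun y ↦ inner ℝ (X y) (Z y)) x (Y x)
  - mvfderiv 𝓘(ℝ, E) (fun y ↦ inner ℝ (X y) (Y y)) x (Z x)
  + inner ℝ (mlieBracket 𝓘(ℝ, E) X Y x) (Z x)
  - inner ℝ (mlieBracket 𝓘(ℝ, E) X Z x) (Y x)
  - inner ℝ (mlieBracket 𝓘(ℝ, E) Y Z x) (X x)

theorem mvfderiv_inner_comm (x : M) (X Y : Π x : M, TangentSpace 𝓘(ℝ, E) x) :
    mvfderiv 𝓘(ℝ, E) (fun y ↦ inner ℝ (X y) (Y y)) x =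
      mvfderiv 𝓘(ℝ, E) (fun y ↦ inner ℝ (Y y) (X y)) x := by
  simp only [real_inner_comm]

theorem koszul_sub_swap (x : M) (X Y Z : Π x : M, TangentSpace 𝓘(ℝ, E) x) :
    koszul X Y Z x - koszul Y X Z x = 2 * inner ℝ (mlieBracket 𝓘(ℝ, E) X Y x) (Z x) := by
  have h : mlieBracket 𝓘(ℝ, E) Y X x = - mlieBracket 𝓘(ℝ, E) X Y x := mlieBracket_swap_apply
  unfold koszul
  rw [mvfderiv_inner_comm x Y X, h, inner_neg_left]
  ring

theorem koszul_add_swap (x : M) (X Y Z : Π x : M, TangentSpace 𝓘(ℝ, E) x) :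
    koszul X Y Z x + koszul X Z Y x =
      2 * mvfderiv 𝓘(ℝ, E) (fun y ↦ inner ℝ (Y y) (Z y)) x (X x) := by
  have h : mlieBracket 𝓘(ℝ, E) Z Y x = - mlieBracket 𝓘(ℝ, E) Y Z x := mlieBracket_swap_apply
  unfold koszul
  rw [mvfderiv_inner_comm x Z Y, h, inner_neg_left]
  ring

variable [IsManifold 𝓘(ℝ, E) ∞ M]
  [IsContMDiffRiemannianBundle 𝓘(ℝ, E) ∞ E (fun x : M ↦ TangentSpace 𝓘(ℝ, E) x)]

theorem mdifferentiableAt_inner {x : M} {Y Z : Π x : M, TangentSpace 𝓘(ℝ, E) x}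
    (hY : MDiffAt (T% Y) x) (hZ : MDiffAt (T% Z) x) :
    MDifferentiableAt 𝓘(ℝ, E) 𝓘(ℝ, ℝ) (fun y ↦ inner ℝ (Y y) (Z y)) x :=
  MDifferentiableAt.inner_bundle (F := E) (E := fun x : M ↦ TangentSpace 𝓘(ℝ, E) x) hY hZ

theorem mvfderiv_inner_add {x : M} {X X' Y : Π x : M, TangentSpace 𝓘(ℝ, E) x}
    (hX : MDiffAt (T% X) x) (hX' : MDiffAt (T% X') x) (hY : MDiffAt (T% Y) x) :
    mvfderiv 𝓘(ℝ, E) (fun y ↦ inner ℝ ((X + X') y) (Y y)) x =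
      mvfderiv 𝓘(ℝ, E) (fun y ↦ inner ℝ (X y) (Y y)) x
        + mvfderiv 𝓘(ℝ, E) (fun y ↦ inner ℝ (X' y) (Y y)) x := by
  rw [← mvfderiv_fun_add (mdifferentiableAt_inner hX hY) (mdifferentiableAt_inner hX' hY)]
  simp only [Pi.add_apply, inner_add_left]

theorem mvfderiv_inner_smul {x : M} {f : M → ℝ} {X Y : Π x : M, TangentSpace 𝓘(ℝ, E) x}
    (hf : MDiffAt f x) (hX : MDiffAt (T% X) x) (hY : MDiffAt (T% Y) x) :
    mvfderiv 𝓘(ℝ, E) (fun y ↦ inner ℝ ((f • X) y) (Y y)) x =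
      f x • mvfderiv 𝓘(ℝ, E) (fun y ↦ inner ℝ (X y) (Y y)) x
        + (inner ℝ (X x) (Y x) : ℝ) • mvfderiv 𝓘(ℝ, E) f x := by
  rw [← mvfderiv_fun_mul hf (mdifferentiableAt_inner hX hY)]
  simp only [Pi.smul_apply', inner_smul_left, RCLike.conj_to_real]

variable [FiniteDimensional ℝ E]

theorem koszul_tensorial_left {x : M} {Y Z : Π x : M, TangentSpace 𝓘(ℝ, E) x}
    (hY : MDiffAt (T% Y) x) (hZ : MDiffAt (T% Z) x) :
    TensorialAt 𝓘(ℝ, E) E (fun X ↦ koszul X Y Z x) x where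
  smul {f X} hf hX := by
    unfold koszul
    rw [mvfderiv_inner_smul hf hX hY, mvfderiv_inner_smul hf hX hZ]
    simp only [mlieBracket_smul_left hf hX, Pi.smul_apply', map_smul, inner_add_left,
      inner_smul_left, inner_smul_right, RCLike.conj_to_real, smul_eq_mul, add_apply, smul_apply]
    rw [real_inner_comm (Y x) (X x), real_inner_comm (Z x) (X x)]
    ring
  add {X X'} hX hX' := by
    unfold koszul
    rw [mvfderiv_inner_add hX hX' hY, mvfderiv_inner_add hX hX' hZ]
    simp only [mlieBracket_add_left hX hX', Pi.add_apply, map_add, inner_add_left,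
      inner_add_right, add_apply]
    ring

theorem koszul_tensorial_right {x : M} {X Y : Π x : M, TangentSpace 𝓘(ℝ, E) x}
    (hX : MDiffAt (T% X) x) (hY : MDiffAt (T% Y) x) :
    TensorialAt 𝓘(ℝ, E) E (fun Z ↦ koszul X Y Z x) x where
  smul {f Z} hf hZ := by
    unfold koszul
    rw [mvfderiv_inner_comm x X (f • Z), mvfderiv_inner_comm x Y (f • Z),
      mvfderiv_inner_smul hf hZ hY, mvfderiv_inner_smul hf hZ hX,
      mvfderiv_inner_comm x Z Y, mvfderiv_inner_comm x Z X]
    simp only [mlieBracket_smul_right hf hZ, Pi.smul_apply', map_smul, inner_add_left,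
      inner_smul_left, inner_smul_right, RCLike.conj_to_real, smul_eq_mul, add_apply, smul_apply]
    ring
  add {Z Z'} hZ hZ' := by
    unfold koszul
    rw [mvfderiv_inner_comm x X (Z + Z'), mvfderiv_inner_comm x Y (Z + Z'),
      mvfderiv_inner_add hZ hZ' hX, mvfderiv_inner_add hZ hZ' hY,
      mvfderiv_inner_comm x Z Y, mvfderiv_inner_comm x Z X,
      mvfderiv_inner_comm x Z' Y, mvfderiv_inner_comm x Z' X]
    simp only [mlieBracket_add_right hZ hZ', Pi.add_apply, map_add, inner_add_left,
      inner_add_right, add_apply]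
    ring

theorem koszul_add_middle {x : M} {X Y Y' Z : Π x : M, TangentSpace 𝓘(ℝ, E) x}
    (hX : MDiffAt (T% X) x) (hY : MDiffAt (T% Y) x) (hY' : MDiffAt (T% Y') x)
    (hZ : MDiffAt (T% Z) x) :
    koszul X (Y + Y') Z x = koszul X Y Z x + koszul X Y' Z x := by
  unfold koszul
  rw [mvfderiv_inner_comm x X (Y + Y'), mvfderiv_inner_add hY hY' hX,
    mvfderiv_inner_add hY hY' hZ, mvfderiv_inner_comm x Y X, mvfderiv_inner_comm x Y' X]
  simp only [mlieBracket_add_right hY hY', mlieBracket_add_left hY hY', Pi.add_apply, map_add,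
    inner_add_left, inner_add_right, add_apply]
  ring

theorem koszul_smul_middle {x : M} {f : M → ℝ} {X Y Z : Π x : M, TangentSpace 𝓘(ℝ, E) x}
    (hf : MDiffAt f x) (hX : MDiffAt (T% X) x) (hY : MDiffAt (T% Y) x)
    (hZ : MDiffAt (T% Z) x) :
    koszul X (f • Y) Z x =
      f x * koszul X Y Z x + 2 * (mvfderiv 𝓘(ℝ, E) f x (X x) * inner ℝ (Y x) (Z x)) := by
  unfold koszul
  rw [mvfderiv_inner_comm x X (f • Y), mvfderiv_inner_smul hf hY hX,
    mvfderiv_inner_smul hf hY hZ, mvfderiv_inner_comm x Y X]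
  simp only [mlieBracket_smul_right hf hY, mlieBracket_smul_left hf hY, Pi.smul_apply', map_smul,
    inner_add_left, inner_smul_left, inner_smul_right, RCLike.conj_to_real, smul_eq_mul,
    add_apply, smul_apply]
  rw [real_inner_comm (Z x) (Y x), real_inner_comm (X x) (Y x)]
  ring

open Classical in
/-- The Koszul expression of `Y` at `x`, as a bilinear form in the values of `X` and `Z` at `x`
(and `0` if `Y` is not differentiable at `x`). -/
def koszulForm (Y : Π x : M, TangentSpace 𝓘(ℝ, E) x) (x : M) :
    TangentSpace 𝓘(ℝ, E) x →L[ℝ] TangentSpace 𝓘(ℝ, E) x →L[ℝ] ℝ :=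
  if hY : MDiffAt (T% Y) x then
    TensorialAt.mkHom₂ (V := TangentSpace 𝓘(ℝ, E)) (V' := TangentSpace 𝓘(ℝ, E))
      (fun X Z ↦ koszul X Y Z x) x
      (fun _ hZ ↦ koszul_tensorial_left hY hZ) (fun _ hX ↦ koszul_tensorial_right hX hY)
  else 0

theorem koszulForm_apply {x : M} {X Y Z : Π x : M, TangentSpace 𝓘(ℝ, E) x}
    (hX : MDiffAt (T% X) x) (hY : MDiffAt (T% Y) x) (hZ : MDiffAt (T% Z) x) :
    koszulForm Y x (X x) (Z x) = koszul X Y Z x := by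
  rw [koszulForm, dif_pos hY]
  exact TensorialAt.mkHom₂_apply (V := TangentSpace 𝓘(ℝ, E)) (V' := TangentSpace 𝓘(ℝ, E))
    _ _ hX hZ

/-- The map `u ↦ ∇_u Y` at `x`, given by the Koszul formula. -/
def leviCivitaFun (Y : Π x : M, TangentSpace 𝓘(ℝ, E) x) (x : M) :
    TangentSpace 𝓘(ℝ, E) x →L[ℝ] TangentSpace 𝓘(ℝ, E) x :=
  LinearMap.toContinuousLinearMap
    { toFun u := (1 / 2 : ℝ) •
        (InnerProductSpace.toDual ℝ (TangentSpace 𝓘(ℝ, E) x)).symm (koszulForm Y x u)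
      map_add' u v := by simp
      map_smul' c u := by
        rw [map_smul, LinearIsometryEquiv.map_smulₛₗ, RCLike.conj_to_real, RingHom.id_apply,
          smul_comm] }

theorem inner_leviCivitaFun {x : M} {X Y Z : Π x : M, TangentSpace 𝓘(ℝ, E) x}
    (hX : MDiffAt (T% X) x) (hY : MDiffAt (T% Y) x) (hZ : MDiffAt (T% Z) x) :
    2 * inner ℝ (leviCivitaFun Y x (X x)) (Z x) = koszul X Y Z x := by
  rw [← koszulForm_apply hX hY hZ]
  simp [leviCivitaFun, inner_smul_left]

/-- The Levi-Civita connection; `leviCivita Y x u` is `∇_u Y` at `x`. -/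
def leviCivita : CovariantDerivative 𝓘(ℝ, E) E (TangentSpace 𝓘(ℝ, E) : M → Type _) where
  toFun := leviCivitaFun
  isCovariantDerivativeOnUniv :=
  { add := by
      intro Y Y' x hY hY' _
      ext u
      refine ext_inner_right ℝ fun w ↦ ?_
      have hX := mdifferentiableAt_extend 𝓘(ℝ, E) E u
      have hZ := mdifferentiableAt_extend 𝓘(ℝ, E) E w
      have h1 := inner_leviCivitaFun hX hY hZ
      have h2 := inner_leviCivitaFun hX hY' hZ
      have h3 := inner_leviCivitaFun hX (mdifferentiableAt_add_section hY hY') hZ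
      rw [koszul_add_middle hX hY hY' hZ] at h3
      simp only [extend_apply_self] at h1 h2 h3
      rw [add_apply, inner_add_left]
      linarith
    leibniz := by
      intro Y f x hY hf _
      ext u
      refine ext_inner_right ℝ fun w ↦ ?_
      have hX := mdifferentiableAt_extend 𝓘(ℝ, E) E u
      have hZ := mdifferentiableAt_extend 𝓘(ℝ, E) E w
      have h1 := inner_leviCivitaFun hX hY hZ
      have h3 := inner_leviCivitaFun hX (hf.smul_section hY) hZ
      rw [koszul_smul_middle hf hX hY hZ] at h3
      simp only [extend_apply_self] at h1 h3
      rw [add_apply, inner_add_left, smul_apply, inner_smul_left,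
        ContinuousLinearMap.smulRight_apply, inner_smul_left]
      simp only [RCLike.conj_to_real]
      rw [← h1] at h3
      linarith }

theorem inner_leviCivita {x : M} {X Y Z : Π x : M, TangentSpace 𝓘(ℝ, E) x}
    (hX : MDiffAt (T% X) x) (hY : MDiffAt (T% Y) x) (hZ : MDiffAt (T% Z) x) :
    2 * inner ℝ (leviCivita Y x (X x)) (Z x) = koszul X Y Z x :=
  inner_leviCivitaFun hX hY hZ

/-- The Levi-Civita connection is torsion-free. -/
theorem leviCivita_torsion {x : M} {X Y : Π x : M, TangentSpace 𝓘(ℝ, E) x}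
    (hX : MDiffAt (T% X) x) (hY : MDiffAt (T% Y) x) :
    leviCivita Y x (X x) - leviCivita X x (Y x) = mlieBracket 𝓘(ℝ, E) X Y x := by
  refine ext_inner_right ℝ fun w ↦ ?_
  have hZ := mdifferentiableAt_extend 𝓘(ℝ, E) E w
  have h1 := inner_leviCivita hX hY hZ
  have h2 := inner_leviCivita hY hX hZ
  have h3 := koszul_sub_swap x X Y (extend E w)
  simp only [extend_apply_self] at h1 h2 h3
  rw [inner_sub_left]
  linarith

/-- The Levi-Civita connection is compatible with the metric. -/
theorem leviCivita_metric {x : M} {X Y Z : Π x : M, TangentSpace 𝓘(ℝ, E) x}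
    (hX : MDiffAt (T% X) x) (hY : MDiffAt (T% Y) x) (hZ : MDiffAt (T% Z) x) :
    mvfderiv 𝓘(ℝ, E) (fun y ↦ inner ℝ (Y y) (Z y)) x (X x) =
      inner ℝ (leviCivita Y x (X x)) (Z x) + inner ℝ (Y x) (leviCivita Z x (X x)) := by
  have h1 := inner_leviCivita hX hY hZ
  have h2 := inner_leviCivita hX hZ hY
  have h3 := koszul_add_swap x X Y Z
  rw [real_inner_comm (leviCivita Z x (X x)) (Y x)] at *
  linarith

end LeviCivita

/-- A Riemannian manifold is flat if the curvature
`R(X, Y)Z = ∇_X ∇_Y Z - ∇_Y ∇_X Z - ∇_[X, Y] Z` of its Levi-Civita connection vanishes. -/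
def IsFlat (E : Type*) [NormedAddCommGroup E] [NormedSpace ℝ E] [FiniteDimensional ℝ E]
    (M : Type*) [TopologicalSpace M] [ChartedSpace E M] [IsManifold 𝓘(ℝ, E) ∞ M]
    [RiemannianBundle (fun x : M ↦ TangentSpace 𝓘(ℝ, E) x)]
    [IsContMDiffRiemannianBundle 𝓘(ℝ, E) ∞ E (fun x : M ↦ TangentSpace 𝓘(ℝ, E) x)] : Prop :=
  ∀ X Y Z : Π x : M, TangentSpace 𝓘(ℝ, E) x,
    ContMDiff 𝓘(ℝ, E) (𝓘(ℝ, E).prod 𝓘(ℝ, E)) ∞ (fun x ↦ (⟨x, X x⟩ : TangentBundle 𝓘(ℝ, E) M)) →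
    ContMDiff 𝓘(ℝ, E) (𝓘(ℝ, E).prod 𝓘(ℝ, E)) ∞ (fun x ↦ (⟨x, Y x⟩ : TangentBundle 𝓘(ℝ, E) M)) →
    ContMDiff 𝓘(ℝ, E) (𝓘(ℝ, E).prod 𝓘(ℝ, E)) ∞ (fun x ↦ (⟨x, Z x⟩ : TangentBundle 𝓘(ℝ, E) M)) →
    ∀ p : M,
      leviCivita (fun x ↦ leviCivita Z x (Y x)) p (X p)
        - leviCivita (fun x ↦ leviCivita Z x (X x)) p (Y p)
        - leviCivita Z p (mlieBracket 𝓘(ℝ, E) X Y p) = 0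

/-- `J` makes the Riemannian manifold `N` a Kähler manifold: it is a smooth almost complex
structure which is orthogonal for the metric and parallel for the Levi-Civita connection (such a
`J` is integrable). -/
structure IsKahler {E' : Type*} [NormedAddCommGroup E'] [NormedSpace ℝ E'] [FiniteDimensional ℝ E']
    {N : Type*} [TopologicalSpace N] [ChartedSpace E' N] [IsManifold 𝓘(ℝ, E') ∞ N]
    [RiemannianBundle (fun y : N ↦ TangentSpace 𝓘(ℝ, E') y)]
    [IsContMDiffRiemannianBundle 𝓘(ℝ, E') ∞ E' (fun y : N ↦ TangentSpace 𝓘(ℝ, E') y)]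
    (J : Π y : N, TangentSpace 𝓘(ℝ, E') y →L[ℝ] TangentSpace 𝓘(ℝ, E') y) : Prop where
  contMDiff : ContMDiff 𝓘(ℝ, E') (𝓘(ℝ, E').prod 𝓘(ℝ, E' →L[ℝ] E')) ∞
    (fun y ↦ (TotalSpace.mk' (E' →L[ℝ] E') y (J y) : TotalSpace (E' →L[ℝ] E')
      (fun y : N ↦ TangentSpace 𝓘(ℝ, E') y →L[ℝ] TangentSpace 𝓘(ℝ, E') y)))
  sq : ∀ (y : N) (v : TangentSpace 𝓘(ℝ, E') y), J y (J y v) = -v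
  inner_map : ∀ (y : N) (v w : TangentSpace 𝓘(ℝ, E') y),
    (inner ℝ (J y v) (J y w) : ℝ) = inner ℝ v w
  parallel : ∀ (y : N) (Y : Π y : N, TangentSpace 𝓘(ℝ, E') y),
    MDifferentiableAt 𝓘(ℝ, E') (𝓘(ℝ, E').prod 𝓘(ℝ, E'))
      (fun z ↦ (⟨z, Y z⟩ : TangentBundle 𝓘(ℝ, E') N)) y →
    ∀ v : TangentSpace 𝓘(ℝ, E') y,
      leviCivita (fun z ↦ J z (Y z)) y v = J y (leviCivita Y y v)

/-! ### Isometrically immersed submanifolds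

Throughout, `F : M → N` is the immersion, and a vector field along `F` is a family of vectors
`V x` tangent to `N` at `F x`. -/

section Submanifold

variable (E : Type*) [NormedAddCommGroup E] [NormedSpace ℝ E]
  {M : Type*} [TopologicalSpace M] [ChartedSpace E M]
  (E' : Type*) [NormedAddCommGroup E'] [NormedSpace ℝ E']
  {N : Type*} [TopologicalSpace N] [ChartedSpace E' N]

variable [RiemannianBundle (fun x : M ↦ TangentSpace 𝓘(ℝ, E) x)]
  [RiemannianBundle (fun y : N ↦ TangentSpace 𝓘(ℝ, E') y)]

/-- `F` is a smooth isometric immersion: it is smooth, and the metric of `M` is induced by `F`. -/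
structure IsIsometricImmersion (F : M → N) : Prop where
  contMDiff : ContMDiff 𝓘(ℝ, E) 𝓘(ℝ, E') ∞ F
  inner_map : ∀ (p : M) (u v : TangentSpace 𝓘(ℝ, E) p),
    (inner ℝ (mfderiv 𝓘(ℝ, E) 𝓘(ℝ, E') F p u) (mfderiv 𝓘(ℝ, E) 𝓘(ℝ, E') F p v) : ℝ)
      = inner ℝ u v

/-- `M` is totally real: `J` maps each tangent space of `M` into the normal space. -/
def IsTotallyReal (F : M → N)
    (J : Π y : N, TangentSpace 𝓘(ℝ, E') y →L[ℝ] TangentSpace 𝓘(ℝ, E') y) : Prop :=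
  ∀ (p : M) (u v : TangentSpace 𝓘(ℝ, E) p),
    (inner ℝ (J (F p) (mfderiv 𝓘(ℝ, E) 𝓘(ℝ, E') F p u)) (mfderiv 𝓘(ℝ, E) 𝓘(ℝ, E') F p v) : ℝ) = 0

variable [IsManifold 𝓘(ℝ, E') ∞ N]

/-- `ξ` is a smooth normal vector field of `M`. -/
structure IsNormalField (F : M → N) (ξ : Π x : M, TangentSpace 𝓘(ℝ, E') (F x)) : Prop where
  contMDiff : ContMDiff 𝓘(ℝ, E) (𝓘(ℝ, E').prod 𝓘(ℝ, E')) ∞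
    (fun x ↦ (⟨F x, ξ x⟩ : TangentBundle 𝓘(ℝ, E') N))
  normal : ∀ (p : M) (u : TangentSpace 𝓘(ℝ, E) p),
    (inner ℝ (mfderiv 𝓘(ℝ, E) 𝓘(ℝ, E') F p u) (ξ p) : ℝ) = 0

variable [FiniteDimensional ℝ E] [FiniteDimensional ℝ E']

/-- The tangential component of a vector of `N` at `F p`, as a tangent vector of `M` at `p`. It is
the adjoint of the differential; since the latter is isometric, it is characterized by
`tangentPart_mfderiv` and `tangentPart_eq_zero`. -/
def tangentPart (F : M → N) (p : M) :
    TangentSpace 𝓘(ℝ, E') (F p) →L[ℝ] TangentSpace 𝓘(ℝ, E) p :=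
  ContinuousLinearMap.adjoint (mfderiv 𝓘(ℝ, E) 𝓘(ℝ, E') F p)

theorem tangentPart_mfderiv {F : M → N} (hF : IsIsometricImmersion E E' F) (p : M)
    (u : TangentSpace 𝓘(ℝ, E) p) :
    tangentPart E E' F p (mfderiv 𝓘(ℝ, E) 𝓘(ℝ, E') F p u) = u := by
  refine ext_inner_right ℝ fun w ↦ ?_
  rw [tangentPart, ContinuousLinearMap.adjoint_inner_left, hF.inner_map]

theorem tangentPart_eq_zero (F : M → N) (p : M) (ξ : TangentSpace 𝓘(ℝ, E') (F p))
    (h : ∀ u : TangentSpace 𝓘(ℝ, E) p,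
      (inner ℝ (mfderiv 𝓘(ℝ, E) 𝓘(ℝ, E') F p u) ξ : ℝ) = 0) :
    tangentPart E E' F p ξ = 0 := by
  refine ext_inner_right ℝ fun w ↦ ?_
  rw [tangentPart, ContinuousLinearMap.adjoint_inner_left, real_inner_comm, h, inner_zero_left]

/-- The normal component of a vector of `N` at `F p`. -/
def normalPart (F : M → N) (p : M) :
    TangentSpace 𝓘(ℝ, E') (F p) →L[ℝ] TangentSpace 𝓘(ℝ, E') (F p) :=
  ContinuousLinearMap.id ℝ _ - mfderiv 𝓘(ℝ, E) 𝓘(ℝ, E') F p ∘L tangentPart E E' F p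

theorem inner_normalPart {F : M → N} (hF : IsIsometricImmersion E E' F) (p : M)
    (u : TangentSpace 𝓘(ℝ, E) p) (v : TangentSpace 𝓘(ℝ, E') (F p)) :
    (inner ℝ (mfderiv 𝓘(ℝ, E) 𝓘(ℝ, E') F p u) (normalPart E E' F p v) : ℝ) = 0 := by
  rw [normalPart, sub_apply, inner_sub_right, ContinuousLinearMap.comp_apply, hF.inner_map,
    tangentPart, ContinuousLinearMap.adjoint_inner_right]
  simp

variable [IsContMDiffRiemannianBundle 𝓘(ℝ, E') ∞ E' (fun y : N ↦ TangentSpace 𝓘(ℝ, E') y)]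

/-- The covariant derivative `u ↦ ∇̃_u V` of a vector field `V` along `F` at `p`, induced by the
Levi-Civita connection of `N`. In the trivialization `e` of the tangent bundle of `N` around
`F p`, with `V` given by the function `x ↦ (e ⟨F x, V x⟩).2`, it is the derivative of this function
plus the derivative in the direction `dF u` of the section of constant coordinates through
`V p`. -/
def covAlong (F : M → N) (V : Π x : M, TangentSpace 𝓘(ℝ, E') (F x)) (p : M) :
    TangentSpace 𝓘(ℝ, E) p →L[ℝ] TangentSpace 𝓘(ℝ, E') (F p) :=
  (trivializationAt E' (TangentSpace 𝓘(ℝ, E')) (F p)).symmL ℝ (F p) ∘L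
      mvfderiv 𝓘(ℝ, E)
        (fun x ↦ (trivializationAt E' (TangentSpace 𝓘(ℝ, E')) (F p) ⟨F x, V x⟩).2) p
    + leviCivita (extend E' (V p)) (F p) ∘L mfderiv 𝓘(ℝ, E) 𝓘(ℝ, E') F p

/-- The coordinates of the vector field `W` in the trivialization of the tangent bundle
around `q`. -/
def coordAt (q : N) (W : Π y : N, TangentSpace 𝓘(ℝ, E') y) (y : N) : E' :=
  (trivializationAt E' (TangentSpace 𝓘(ℝ, E')) q ⟨y, W y⟩).2

theorem mvfderiv_congr {f g : N → E'} {q : N} (h : f =ᶠ[nhds q] g) :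
    mvfderiv 𝓘(ℝ, E') f q = mvfderiv 𝓘(ℝ, E') g q := by
  ext u
  have h1 : mfderiv 𝓘(ℝ, E') 𝓘(ℝ, E') f q = mfderiv 𝓘(ℝ, E') 𝓘(ℝ, E') g q := h.mfderiv_eq
  exact congrArg (fun L : E' →L[ℝ] E' ↦ L u) h1

theorem tensorial_coordAt (q : N) :
    TensorialAt 𝓘(ℝ, E') E' (fun W : Π y : N, TangentSpace 𝓘(ℝ, E') y ↦
      leviCivita W q - (trivializationAt E' (TangentSpace 𝓘(ℝ, E')) q).symmL ℝ q ∘L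
        mvfderiv 𝓘(ℝ, E') (coordAt E' q W) q) q where
  smul {f W} hf hW := by
    have hq := FiberBundle.mem_baseSet_trivializationAt' (F := E') (E := TangentSpace 𝓘(ℝ, E')) q
    have h : coordAt E' q (f • W) =ᶠ[nhds q] f • coordAt E' q W := by
      filter_upwards [(trivializationAt E' (TangentSpace 𝓘(ℝ, E')) q).open_baseSet.mem_nhds hq]
        with y hy
      exact ((trivializationAt E' (TangentSpace 𝓘(ℝ, E')) q).linear ℝ hy).map_smul (f y) (W y)
    have hc : MDifferentiableAt 𝓘(ℝ, E') 𝓘(ℝ, E') (coordAt E' q W) q :=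
      (mdifferentiableAt_section 𝓘(ℝ, E') W).1 hW
    rw [mvfderiv_congr E' h, mvfderiv_smul hf hc, leviCivita.isCovariantDerivativeOn.leibniz hW hf]
    have h2 : (trivializationAt E' (TangentSpace 𝓘(ℝ, E')) q).symmL ℝ q (coordAt E' q W q) = W q := by
      have := (trivializationAt E' (TangentSpace 𝓘(ℝ, E')) q).symmL_continuousLinearMapAt
        (R := ℝ) hq (W q)
      rwa [(trivializationAt E' (TangentSpace 𝓘(ℝ, E')) q).continuousLinearMapAt_apply_of_mem ℝ hq]
        at this
    ext u
    simp [h2, smul_sub]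
  add {W W'} hW hW' := by
    have hq := FiberBundle.mem_baseSet_trivializationAt' (F := E') (E := TangentSpace 𝓘(ℝ, E')) q
    have h : coordAt E' q (W + W') =ᶠ[nhds q] coordAt E' q W + coordAt E' q W' := by
      filter_upwards [(trivializationAt E' (TangentSpace 𝓘(ℝ, E')) q).open_baseSet.mem_nhds hq]
        with y hy
      exact ((trivializationAt E' (TangentSpace 𝓘(ℝ, E')) q).linear ℝ hy).map_add (W y) (W' y)
    have hc : MDifferentiableAt 𝓘(ℝ, E') 𝓘(ℝ, E') (coordAt E' q W) q :=
      (mdifferentiableAt_section 𝓘(ℝ, E') W).1 hW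
    have hc' : MDifferentiableAt 𝓘(ℝ, E') 𝓘(ℝ, E') (coordAt E' q W') q :=
      (mdifferentiableAt_section 𝓘(ℝ, E') W').1 hW'
    rw [mvfderiv_congr E' h, mvfderiv_add hc hc', leviCivita.isCovariantDerivativeOn.add hW hW']
    ext u
    simp
    abel

/-- The covariant derivative along `F` restricts to `∇̃` on vector fields of `N`. -/
theorem covAlong_comp (F : M → N) (p : M) (hF : MDifferentiableAt 𝓘(ℝ, E) 𝓘(ℝ, E') F p)
    (W : Π y : N, TangentSpace 𝓘(ℝ, E') y) (hW : MDiffAt (T% W) (F p)) :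
    covAlong E E' F (fun x ↦ W (F x)) p =
      leviCivita W (F p) ∘L mfderiv 𝓘(ℝ, E) 𝓘(ℝ, E') F p := by
  have hq := FiberBundle.mem_baseSet_trivializationAt' (F := E') (E := TangentSpace 𝓘(ℝ, E')) (F p)
  have key := (tensorial_coordAt E' (F p)).pointwise hW
    (mdifferentiableAt_extend 𝓘(ℝ, E') E' (W (F p))) (extend_apply_self (F := E') (W (F p))).symm
  have h : coordAt E' (F p) (extend E' (W (F p))) =ᶠ[nhds (F p)]
      fun _ ↦ (trivializationAt E' (TangentSpace 𝓘(ℝ, E')) (F p) ⟨F p, W (F p)⟩).2 := by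
    filter_upwards [(trivializationAt E' (TangentSpace 𝓘(ℝ, E')) (F p)).open_baseSet.mem_nhds hq]
      with y hy
    have h1 := congrArg Prod.snd
      ((trivializationAt E' (TangentSpace 𝓘(ℝ, E')) (F p)).apply_mk_symm hy
        (trivializationAt E' (TangentSpace 𝓘(ℝ, E')) (F p) ⟨F p, W (F p)⟩).2)
    exact h1
  rw [mvfderiv_congr E' h, mvfderiv_const, ContinuousLinearMap.comp_zero, sub_zero] at key
  have hc : MDifferentiableAt 𝓘(ℝ, E') 𝓘(ℝ, E') (coordAt E' (F p) W) (F p) :=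
    (mdifferentiableAt_section 𝓘(ℝ, E') W).1 hW
  have h3 : mvfderiv 𝓘(ℝ, E) (coordAt E' (F p) W ∘ F) p =
      mvfderiv 𝓘(ℝ, E') (coordAt E' (F p) W) (F p) ∘L mfderiv 𝓘(ℝ, E) 𝓘(ℝ, E') F p :=
    mfderiv_comp p hc hF
  have h4 : (fun x ↦ (trivializationAt E' (TangentSpace 𝓘(ℝ, E')) (F p) ⟨F x, W (F x)⟩).2) =
    coordAt E' (F p) W ∘ F := rfl
  rw [covAlong, h4, h3, ← key]
  ext u
  simp

/-- The normal connection: `D_u ξ` is the normal component of `∇̃_u ξ`. -/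
def normalDeriv (F : M → N) (ξ : Π x : M, TangentSpace 𝓘(ℝ, E') (F x)) (p : M) :
    TangentSpace 𝓘(ℝ, E) p →L[ℝ] TangentSpace 𝓘(ℝ, E') (F p) :=
  normalPart E E' F p ∘L covAlong E E' F ξ p

/-- The shape operator `A_ξ`: `-A_ξ u` is the tangential component of `∇̃_u ξ`. -/
def shapeOperator (F : M → N) (ξ : Π x : M, TangentSpace 𝓘(ℝ, E') (F x)) (p : M) :
    TangentSpace 𝓘(ℝ, E) p →L[ℝ] TangentSpace 𝓘(ℝ, E) p :=
  -(tangentPart E E' F p ∘L covAlong E E' F ξ p)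

/-- `M` has commutative second fundamental forms: `[A_ξ, A_η] = 0` for all normal vector fields. -/
def HasCommutativeSecondFundamentalForms (F : M → N) : Prop :=
  ∀ ξ η : Π x : M, TangentSpace 𝓘(ℝ, E') (F x), IsNormalField E E' F ξ → IsNormalField E E' F η →
    ∀ p : M, shapeOperator E E' F ξ p ∘L shapeOperator E E' F η p
      = shapeOperator E E' F η p ∘L shapeOperator E E' F ξ p

/-- The `f`-structure in the normal bundle: `f ξ` is the normal component of `J ξ`. -/
def fStructure (F : M → N)
    (J : Π y : N, TangentSpace 𝓘(ℝ, E') y →L[ℝ] TangentSpace 𝓘(ℝ, E') y) (p : M) :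
    TangentSpace 𝓘(ℝ, E') (F p) →L[ℝ] TangentSpace 𝓘(ℝ, E') (F p) :=
  normalPart E E' F p ∘L J (F p)

/-- The `f`-structure in the normal bundle is parallel: `D_u (f ξ) = f (D_u ξ)` for all normal
vector fields `ξ`. -/
def HasParallelFStructure (F : M → N)
    (J : Π y : N, TangentSpace 𝓘(ℝ, E') y →L[ℝ] TangentSpace 𝓘(ℝ, E') y) : Prop :=
  ∀ ξ : Π x : M, TangentSpace 𝓘(ℝ, E') (F x), IsNormalField E E' F ξ →
    ∀ (p : M) (u : TangentSpace 𝓘(ℝ, E) p),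
      normalDeriv E E' F (fun x ↦ fStructure E E' F J x (ξ x)) p u
        = fStructure E E' F J p (normalDeriv E E' F ξ p u)

variable [IsManifold 𝓘(ℝ, E) ∞ M]
  [IsContMDiffRiemannianBundle 𝓘(ℝ, E) ∞ E (fun x : M ↦ TangentSpace 𝓘(ℝ, E) x)]

/-- The second fundamental form on vector fields, by the Gauss formula
`∇̃_X Y = ∇_X Y + σ(X, Y)`, where `∇` is the Levi-Civita connection of `M`. -/
def secondFundamentalForm (F : M → N) (X Y : Π x : M, TangentSpace 𝓘(ℝ, E) x) (p : M) :
    TangentSpace 𝓘(ℝ, E') (F p) :=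
  covAlong E E' F (fun x ↦ mfderiv 𝓘(ℝ, E) 𝓘(ℝ, E') F x (Y x)) p (X p)
    - mfderiv 𝓘(ℝ, E) 𝓘(ℝ, E') F p (leviCivita Y p (X p))

/-- The second fundamental form on tangent vectors at `p`, evaluated on extensions of these
vectors that are smooth near `p`. -/
def secondFundamentalFormAt (F : M → N) (p : M) (u v : TangentSpace 𝓘(ℝ, E) p) :
    TangentSpace 𝓘(ℝ, E') (F p) :=
  secondFundamentalForm E E' F (extend E u) (extend E v) p

/-- `M` is totally geodesic: `σ = 0`. -/
def IsTotallyGeodesic (F : M → N) : Prop :=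
  ∀ (p : M) (u v : TangentSpace 𝓘(ℝ, E) p), secondFundamentalFormAt E E' F p u v = 0

/-- The mean curvature vector `H = (1 / n) tr σ`, with `n = dim M`. -/
def meanCurvature (F : M → N) (p : M) : TangentSpace 𝓘(ℝ, E') (F p) :=
  (Module.finrank ℝ E : ℝ)⁻¹ • ∑ i,
    secondFundamentalFormAt E E' F p (stdOrthonormalBasis ℝ (TangentSpace 𝓘(ℝ, E) p) i)
      (stdOrthonormalBasis ℝ (TangentSpace 𝓘(ℝ, E) p) i)

/-- The mean curvature vector is parallel in the normal bundle: `D H = 0`. -/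
def HasParallelMeanCurvature (F : M → N) : Prop :=
  ∀ (p : M) (u : TangentSpace 𝓘(ℝ, E) p), normalDeriv E E' F (meanCurvature E E' F) p u = 0

end Submanifold

end

end TotReal

namespace TotReal

noncomputable section

section Calculus

variable {E : Type*} [NormedAddCommGroup E] [NormedSpace ℝ E]
  {M : Type*} [TopologicalSpace M] [ChartedSpace E M] [IsManifold 𝓘(ℝ, E) ∞ M]
  {E' : Type*} [NormedAddCommGroup E'] [NormedSpace ℝ E']
  {N : Type*} [TopologicalSpace N] [ChartedSpace E' N] [IsManifold 𝓘(ℝ, E') ∞ N]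
  {G : Type*} [NormedAddCommGroup G] [NormedSpace ℝ G]

theorem contMDiffAt_mfderiv_apply {F : M → N} {X : Π x : M, TangentSpace 𝓘(ℝ, E) x} {p : M}
    (hF : ContMDiffAt 𝓘(ℝ, E) 𝓘(ℝ, E') ∞ F p) (hX : CMDiffAt ∞ (T% X) p) :
    ContMDiffAt 𝓘(ℝ, E) (𝓘(ℝ, E').prod 𝓘(ℝ, E')) ∞
      (fun x ↦ (⟨F x, mfderiv 𝓘(ℝ, E) 𝓘(ℝ, E') F x (X x)⟩ : TangentBundle 𝓘(ℝ, E') N)) p := by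
  have hϕ := hF.mfderiv_const (m := ∞) (by simp)
  exact ContMDiffAt.clm_apply_of_inCoordinates (b₁ := fun x : M ↦ x) hϕ hX hF

theorem contMDiffAt_mvfderiv_apply {f : M → G} {X : Π x : M, TangentSpace 𝓘(ℝ, E) x} {p : M}
    (hf : ContMDiffAt 𝓘(ℝ, E) 𝓘(ℝ, G) ∞ f p) (hX : CMDiffAt ∞ (T% X) p) :
    ContMDiffAt 𝓘(ℝ, E) 𝓘(ℝ, G) ∞ (fun x ↦ mvfderiv 𝓘(ℝ, E) f x (X x)) p :=
  (contMDiff_snd_tangentBundle_modelSpace G 𝓘(ℝ, G)).contMDiffAt.comp p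
    (contMDiffAt_mfderiv_apply hf hX)

theorem eventually_mdifferentiableAt {H : Type*} [TopologicalSpace H]
    {I : ModelWithCorners ℝ E H} {M : Type*} [TopologicalSpace M] [ChartedSpace H M]
    [IsManifold I 1 M] {H' : Type*} [TopologicalSpace H'] {I' : ModelWithCorners ℝ E' H'}
    {N : Type*} [TopologicalSpace N] [ChartedSpace H' N] [IsManifold I' 1 N]
    {f : M → N} {p : M} (hf : ContMDiffAt I I' ∞ f p) :
    ∀ᶠ x in nhds p, MDifferentiableAt I I' f x := by
  have h1 : ContMDiffAt I I' 1 f p := hf.of_le (by simp)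
  filter_upwards [(contMDiffAt_iff_contMDiffAt_nhds (by simp)).1 h1] with x hx
  exact hx.mdifferentiableAt one_ne_zero

theorem mvfderiv_mlieBracket [CompleteSpace E] {f : M → G}
    {X Y : Π x : M, TangentSpace 𝓘(ℝ, E) x} {p : M}
    (hf : ContMDiffAt 𝓘(ℝ, E) 𝓘(ℝ, G) ∞ f p)
    (hX : CMDiffAt ∞ (T% X) p) (hY : CMDiffAt ∞ (T% Y) p) :
    mvfderiv 𝓘(ℝ, E) f p (mlieBracket 𝓘(ℝ, E) X Y p) =
      mvfderiv 𝓘(ℝ, E) (fun x ↦ mvfderiv 𝓘(ℝ, E) f x (Y x)) p (X p)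
        - mvfderiv 𝓘(ℝ, E) (fun x ↦ mvfderiv 𝓘(ℝ, E) f x (X x)) p (Y p) := by
  set φ := extChartAt 𝓘(ℝ, E) p with hφ
  have htgt : φ.target ∈ nhds (φ p) := extChartAt_target_mem_nhds p
  have hsymm : φ.symm (φ p) = p := extChartAt_to_inv p
  have hsm : ContMDiffAt 𝓘(ℝ, E) 𝓘(ℝ, E) ∞ φ.symm (φ p) :=
    (contMDiffOn_extChartAt_symm p).contMDiffAt htgt
  -- the fields in the chart
  let pb : (Π x : M, TangentSpace 𝓘(ℝ, E) x) → E → E := fun Z ↦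
    mpullback 𝓘(ℝ, E) 𝓘(ℝ, E) φ.symm Z
  have hinv : ∀ z ∈ φ.target, (mfderiv 𝓘(ℝ, E) 𝓘(ℝ, E) φ.symm z).IsInvertible := fun z hz ↦ by
    have := isInvertible_mfderivWithin_extChartAt_symm (I := 𝓘(ℝ, E)) hz
    simpa only [modelWithCornersSelf_coe, Set.range_id, mfderivWithin_univ] using this
  have hpb : ∀ Z, ∀ z ∈ φ.target, mfderiv 𝓘(ℝ, E) 𝓘(ℝ, E) φ.symm z (pb Z z) = Z (φ.symm z) := by
    intro Z z hz
    exact (hinv z hz).self_apply_inverse _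
  have hfd : ∀ᶠ z in nhds (φ p), MDifferentiableAt 𝓘(ℝ, E) 𝓘(ℝ, G) f (φ.symm z) := by
    have := hsm.continuousAt.eventually (p := fun x ↦ MDifferentiableAt 𝓘(ℝ, E) 𝓘(ℝ, G) f x)
      (by rw [hsymm]; exact eventually_mdifferentiableAt hf)
    exact this
  have chain : ∀ (g : M → G) (z : E), z ∈ φ.target →
      MDifferentiableAt 𝓘(ℝ, E) 𝓘(ℝ, G) g (φ.symm z) → ∀ Z : Π x : M, TangentSpace 𝓘(ℝ, E) x,
      fderiv ℝ (g ∘ φ.symm) z (pb Z z) = mvfderiv 𝓘(ℝ, E) g (φ.symm z) (Z (φ.symm z)) := by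
    intro g z hz hg Z
    have h1 : MDifferentiableAt 𝓘(ℝ, E) 𝓘(ℝ, E) φ.symm z :=
      ((contMDiffOn_extChartAt_symm p).contMDiffAt
        ((isOpen_extChartAt_target p).mem_nhds hz)).mdifferentiableAt (n := ∞) (by simp)
    have h2 := mfderiv_comp_apply z hg h1 (pb Z z)
    rw [hpb Z z hz, mfderiv_eq_fderiv] at h2
    exact h2
  have key : ∀ X Y : Π x : M, TangentSpace 𝓘(ℝ, E) x, CMDiffAt ∞ (T% X) p → CMDiffAt ∞ (T% Y) p →
      mvfderiv 𝓘(ℝ, E) (fun x ↦ mvfderiv 𝓘(ℝ, E) f x (Y x)) p (X p) =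
        fderiv ℝ (fun z ↦ fderiv ℝ (f ∘ φ.symm) z (pb Y z)) (φ p) (pb X (φ p)) := by
    intro X Y hX hY
    have h1 := chain (fun x ↦ mvfderiv 𝓘(ℝ, E) f x (Y x)) (φ p) (mem_extChartAt_target p)
      (by rw [hsymm]; exact (contMDiffAt_mvfderiv_apply hf hY).mdifferentiableAt (by simp)) X
    rw [hsymm] at h1
    rw [← h1]
    congr 1
    apply Filter.EventuallyEq.fderiv_eq
    filter_upwards [hfd, htgt] with z hz hz'
    exact (chain f z hz' hz Y).symm
  have hpbd : ∀ Z : Π x : M, TangentSpace 𝓘(ℝ, E) x, CMDiffAt ∞ (T% Z) p →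
      DifferentiableAt ℝ (pb Z) (φ p) := by
    intro Z hZ
    have h1 := MDifferentiableWithinAt.differentiableWithinAt_mpullbackWithin_vectorField
      (I := 𝓘(ℝ, E)) (V := Z) (x := p) (s := Set.univ)
      (hZ.mdifferentiableAt (by simp)).mdifferentiableWithinAt
    simp only [modelWithCornersSelf_coe, Set.range_id, mpullbackWithin_univ, Set.preimage_univ,
      Set.univ_inter] at h1
    exact differentiableWithinAt_univ.1 h1
  have hfc : ContDiffAt ℝ ∞ (f ∘ φ.symm) (φ p) := by
    rw [← contMDiffAt_iff_contDiffAt]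
    exact ContMDiffAt.comp (φ p) (by rw [hsymm]; exact hf) hsm
  have hfc1 : DifferentiableAt ℝ (fderiv ℝ (f ∘ φ.symm)) (φ p) :=
    (hfc.fderiv_right (m := 1) (by norm_cast)).differentiableAt (by simp)
  have expand : ∀ X Y : Π x : M, TangentSpace 𝓘(ℝ, E) x, CMDiffAt ∞ (T% X) p → CMDiffAt ∞ (T% Y) p →
      fderiv ℝ (fun z ↦ fderiv ℝ (f ∘ φ.symm) z (pb Y z)) (φ p) (pb X (φ p)) =
        fderiv ℝ (fderiv ℝ (f ∘ φ.symm)) (φ p) (pb X (φ p)) (pb Y (φ p))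
          + fderiv ℝ (f ∘ φ.symm) (φ p) (fderiv ℝ (pb Y) (φ p) (pb X (φ p))) := by
    intro X Y hX hY
    rw [fderiv_clm_apply hfc1 (hpbd Y hY)]
    simp [add_comm]
  have hsymm2 : IsSymmSndFDerivAt ℝ (f ∘ φ.symm) (φ p) :=
    hfc.isSymmSndFDerivAt (by simp; norm_cast)
  -- the bracket
  have hbr : mvfderiv 𝓘(ℝ, E) f p (mlieBracket 𝓘(ℝ, E) X Y p) =
      fderiv ℝ (f ∘ φ.symm) (φ p) (lieBracket ℝ (pb X) (pb Y) (φ p)) := by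
    have hX' : mfderiv 𝓘(ℝ, E) 𝓘(ℝ, E) φ p (mlieBracket 𝓘(ℝ, E) X Y p) =
        lieBracket ℝ (pb X) (pb Y) (φ p) := by
      rw [mlieBracket, mlieBracketWithin_apply]
      simp only [modelWithCornersSelf_coe, Set.range_id, mpullbackWithin_univ, Set.preimage_univ,
        Set.univ_inter]
      refine ((isInvertible_mfderiv_extChartAt (mem_extChartAt_source p)).self_apply_inverse
        _).trans ?_
      exact congrFun (lieBracketWithin_univ (𝕜 := ℝ) (V := pb X) (W := pb Y)) (φ p)
    have hfe : f =ᶠ[nhds p] (f ∘ φ.symm) ∘ φ := by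
      filter_upwards [extChartAt_source_mem_nhds (I := 𝓘(ℝ, E)) p] with x hx
      exact congrArg f (φ.left_inv hx).symm
    have h0 := mfderiv_comp_apply (I := 𝓘(ℝ, E)) (I' := 𝓘(ℝ, E)) (I'' := 𝓘(ℝ, G)) (f := φ)
      (g := f ∘ φ.symm) p (hfc.contMDiffAt.mdifferentiableAt (by simp))
      (mdifferentiableAt_extChartAt (mem_chart_source E p)) (mlieBracket 𝓘(ℝ, E) X Y p)
    rw [hX', mfderiv_eq_fderiv] at h0
    refine Eq.trans ?_ h0
    have h2 : mfderiv 𝓘(ℝ, E) 𝓘(ℝ, G) f p = mfderiv 𝓘(ℝ, E) 𝓘(ℝ, G) ((f ∘ φ.symm) ∘ φ) p :=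
      hfe.mfderiv_eq
    exact congrArg (fun L : E →L[ℝ] G ↦ L (mlieBracket 𝓘(ℝ, E) X Y p)) h2
  rw [hbr, key X Y hX hY, key Y X hY hX, expand X Y hX hY, expand Y X hY hX, lieBracket,
    map_sub, hsymm2.eq (pb X (φ p)) (pb Y (φ p))]
  abel

end Calculus

section Plane

theorem exists_orthogonal_complement_vector {V : Type*} [NormedAddCommGroup V]
    [InnerProductSpace ℝ V] (hV : Module.finrank ℝ V = 2) {a : V} (ha : a ≠ 0) :
    ∃ w : V, inner ℝ w a = (0 : ℝ) ∧
      ∀ v : V, inner ℝ v a = (0 : ℝ) → inner ℝ v w = (0 : ℝ) → v = 0 := by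
  have : Fact (Module.finrank ℝ V = 1 + 1) := ⟨hV⟩
  obtain ⟨⟨w, hw⟩, -, hspan⟩ := finrank_eq_one_iff'.1
    (Submodule.finrank_orthogonal_span_singleton (𝕜 := ℝ) ha)
  refine ⟨w, ?_, fun v hva hvw ↦ ?_⟩
  · rw [real_inner_comm]
    exact Submodule.mem_orthogonal_singleton_iff_inner_right.1 hw
  · obtain ⟨c, hc⟩ := hspan ⟨v, Submodule.mem_orthogonal_singleton_iff_inner_right.2
      (by rw [real_inner_comm]; exact hva)⟩
    have hc' : c • w = v := congrArg Subtype.val hc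
    have : inner ℝ v v = (0 : ℝ) := by
      nth_rewrite 2 [← hc']
      rw [inner_smul_right, hvw, mul_zero]
    exact inner_self_eq_zero.1 this

end Plane

section Constancy

variable {E : Type*} [NormedAddCommGroup E] [NormedSpace ℝ E]
  {M : Type*} [TopologicalSpace M] [ChartedSpace E M] [IsManifold 𝓘(ℝ, E) ∞ M]

theorem eq_of_mvfderiv_eq_zero [PreconnectedSpace M] {f : M → ℝ}
    (hf : ∀ x, MDifferentiableAt 𝓘(ℝ, E) 𝓘(ℝ, ℝ) f x) (h : ∀ x, mvfderiv 𝓘(ℝ, E) f x = 0)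
    (x y : M) : f x = f y := by
  refine IsLocallyConstant.apply_eq_of_isPreconnected ?_ isPreconnected_univ
    (Set.mem_univ x) (Set.mem_univ y)
  refine (IsLocallyConstant.iff_eventually_eq f).2 fun p ↦ ?_
  set φ := extChartAt 𝓘(ℝ, E) p with hφ
  obtain ⟨r, hr, hball⟩ := Metric.mem_nhds_iff.1 (extChartAt_target_mem_nhds (I := 𝓘(ℝ, E)) p)
  have hd : ∀ z ∈ Metric.ball (φ p) r, HasFDerivAt (f ∘ φ.symm) (0 : E →L[ℝ] ℝ) z := by
    intro z hz
    have h1 : MDifferentiableAt 𝓘(ℝ, E) 𝓘(ℝ, E) φ.symm z :=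
      ((contMDiffOn_extChartAt_symm (n := ∞) p).contMDiffAt
        ((isOpen_extChartAt_target p).mem_nhds (hball hz))).mdifferentiableAt (by simp)
    have h2 := (hf (φ.symm z)).hasMFDerivAt.comp z h1.hasMFDerivAt
    have h3 : mfderiv 𝓘(ℝ, E) 𝓘(ℝ, ℝ) f (φ.symm z) = 0 := h (φ.symm z)
    rw [h3, ContinuousLinearMap.zero_comp] at h2
    exact h2.hasFDerivAt
  have hconst : ∀ z ∈ Metric.ball (φ p) r, f (φ.symm z) = f p := by
    intro z hz
    have h0 := (convex_ball (φ p) r).is_const_of_fderivWithin_eq_zero (𝕜 := ℝ) (f := f ∘ φ.symm)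
      (fun w hw ↦ (hd w hw).differentiableAt.differentiableWithinAt)
      (fun w hw ↦ ((hd w hw).hasFDerivWithinAt).fderivWithin
        (Metric.isOpen_ball.uniqueDiffWithinAt hw)) hz (Metric.mem_ball_self hr)
    have h1 : φ.symm (φ p) = p := extChartAt_to_inv p
    rw [Function.comp_apply, Function.comp_apply, h1] at h0
    exact h0
  filter_upwards [extChartAt_source_mem_nhds (I := 𝓘(ℝ, E)) p,
    (continuousAt_extChartAt (I := 𝓘(ℝ, E)) p).preimage_mem_nhds (Metric.ball_mem_nhds _ hr)]
    with q hq hq'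
  rw [← hconst _ hq', φ.left_inv hq]

end Constancy

section LeviCivita

variable {E : Type*} [NormedAddCommGroup E] [NormedSpace ℝ E] [FiniteDimensional ℝ E]
  {M : Type*} [TopologicalSpace M] [ChartedSpace E M] [IsManifold 𝓘(ℝ, E) ∞ M]

theorem exists_contMDiff_apply_eq [T2Space M] {p : M} (v : TangentSpace 𝓘(ℝ, E) p) :
    ∃ X : Π x : M, TangentSpace 𝓘(ℝ, E) x,
      ContMDiff 𝓘(ℝ, E) (𝓘(ℝ, E).prod 𝓘(ℝ, E)) ∞ (T% X) ∧ X p = v := by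
  obtain ⟨s, hs, hsv⟩ := exists_contMDiffOn_extend (k := ∞) 𝓘(ℝ, E) E v
  obtain ⟨f, -, hf⟩ := (SmoothBumpFunction.nhds_basis_tsupport (I := 𝓘(ℝ, E)) p).mem_iff.1
    (interior_mem_nhds.2 hs)
  refine ⟨(f : M → ℝ) • extend E v, ?_, ?_⟩
  · exact ContMDiffOn.smul_section_of_tsupport f.contMDiff.contMDiffOn isOpen_interior hf
      (hsv.mono interior_subset)
  · simp

variable [RiemannianBundle (fun x : M ↦ TangentSpace 𝓘(ℝ, E) x)]
  [IsContMDiffRiemannianBundle 𝓘(ℝ, E) ∞ E (fun x : M ↦ TangentSpace 𝓘(ℝ, E) x)]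

theorem contMDiffAt_inner {Y Z : Π x : M, TangentSpace 𝓘(ℝ, E) x} {p : M}
    (hY : CMDiffAt ∞ (T% Y) p) (hZ : CMDiffAt ∞ (T% Z) p) :
    ContMDiffAt 𝓘(ℝ, E) 𝓘(ℝ, ℝ) ∞ (fun x ↦ (inner ℝ (Y x) (Z x) : ℝ)) p :=
  ContMDiffAt.inner_bundle (F := E) (E := fun x : M ↦ TangentSpace 𝓘(ℝ, E) x) hY hZ

theorem contMDiffAt_of_inner {V : Π x : M, TangentSpace 𝓘(ℝ, E) x} {p : M}
    (h : ∀ W : Π x : M, TangentSpace 𝓘(ℝ, E) x, CMDiffAt ∞ (T% W) p →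
      ContMDiffAt 𝓘(ℝ, E) 𝓘(ℝ, ℝ) ∞ (fun x ↦ (inner ℝ (V x) (W x) : ℝ)) p) :
    CMDiffAt ∞ (T% V) p := by
  classical
  set e := trivializationAt E (TangentSpace 𝓘(ℝ, E)) p
  have hp : p ∈ e.baseSet := FiberBundle.mem_baseSet_trivializationAt' p
  let b := Module.finBasis ℝ E
  let w := e.localFrame b
  have hw : ∀ i, CMDiffAt ∞ (T% (w i)) p := fun i ↦
    contMDiffAt_localFrame_of_mem (I := 𝓘(ℝ, E)) ∞ e b i hp
  let ι := Fin (Module.finrank ℝ E)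
  let c : M → ι → ℝ := fun x i ↦ e.localFrameCoeff 𝓘(ℝ, E) b i x (V x)
  let U : ι → ι → ((ι → ℝ) →L[ℝ] (ι → ℝ)) := fun i j ↦
    (ContinuousLinearMap.proj j : (ι → ℝ) →L[ℝ] ℝ).smulRight (Pi.single i (1 : ℝ))
  let G : M → ((ι → ℝ) →L[ℝ] (ι → ℝ)) := fun x ↦ ∑ i, ∑ j, (inner ℝ (w j x) (w i x) : ℝ) • U i j
  let l : M → ι → ℝ := fun x i ↦ inner ℝ (V x) (w i x)
  have hG : ∀ (x : M) (a : ι → ℝ) (i : ι), G x a i = inner ℝ (∑ j, a j • w j x) (w i x) := by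
    intro x a i
    simp [G, U, sum_inner, inner_smul_left, Pi.single_apply, mul_comm]
    rfl
  have hGs : ContMDiffAt 𝓘(ℝ, E) 𝓘(ℝ, (ι → ℝ) →L[ℝ] (ι → ℝ)) ∞ G p :=
    ContMDiffAt.sum fun i _ ↦ ContMDiffAt.sum fun j _ ↦
      (contMDiffAt_inner (hw j) (hw i)).smul contMDiffAt_const
  have hls : ContMDiffAt 𝓘(ℝ, E) 𝓘(ℝ, ι → ℝ) ∞ l p :=
    contMDiffAt_pi_space.2 fun i ↦ h _ (hw i)
  have hinj : Function.Injective (G p) := by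
    refine (injective_iff_map_eq_zero _).2 fun a ha ↦ ?_
    have h1 : ∑ j, a j • w j p = 0 := by
      refine (inner_self_eq_zero (𝕜 := ℝ)).1 ?_
      rw [inner_sum]
      refine Finset.sum_eq_zero fun i _ ↦ ?_
      rw [inner_smul_right, ← hG, ha, Pi.zero_apply, mul_zero]
    have h2 := (e.isLocalFrameOn_localFrame_baseSet 𝓘(ℝ, E) ∞ b).linearIndependent hp
    funext i
    exact Fintype.linearIndependent_iff.1 h2 a h1 i
  let g : (ι → ℝ) ≃L[ℝ] (ι → ℝ) :=
    (LinearEquiv.ofInjectiveEndo (G p : (ι → ℝ) →ₗ[ℝ] (ι → ℝ)) hinj).toContinuousLinearEquiv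
  have hg : (g : (ι → ℝ) →L[ℝ] (ι → ℝ)) = G p := by
    ext1 a
    rfl
  have hinvs : ContMDiffAt 𝓘(ℝ, E) 𝓘(ℝ, (ι → ℝ) →L[ℝ] (ι → ℝ)) ∞ (fun x ↦ (G x).inverse) p := by
    have h1 := contDiffAt_map_inverse (𝕜 := ℝ) (n := ∞) g
    rw [hg] at h1
    exact h1.contMDiffAt.comp p hGs
  have hinv : ∀ᶠ x in nhds p, (G x).IsInvertible := by
    have h1 := ContinuousLinearEquiv.nhds g
    rw [hg] at h1
    filter_upwards [hGs.continuousAt.eventually h1] with x hx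
    obtain ⟨g', hg'⟩ := hx
    exact ⟨g', hg'⟩
  have hc : ContMDiffAt 𝓘(ℝ, E) 𝓘(ℝ, ι → ℝ) ∞ c p := by
    refine (hinvs.clm_apply hls).congr_of_eventuallyEq ?_
    filter_upwards [hinv, e.open_baseSet.mem_nhds hp] with x hx hxe
    have h1 : G x (c x) = l x := by
      funext i
      rw [hG]
      exact congrArg (fun v ↦ (inner ℝ v (w i x) : ℝ))
        (e.eq_sum_localFrameCoeff_smul (I := 𝓘(ℝ, E)) (b := b) (s := V) hxe).symm
    rw [← h1, hx.inverse_apply_self]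
  exact (contMDiffAt_iff_localFrameCoeff (I := 𝓘(ℝ, E)) b hp).2 (contMDiffAt_pi_space.1 hc)

theorem contMDiffAt_mlieBracket {X Y : Π x : M, TangentSpace 𝓘(ℝ, E) x} {p : M}
    (hX : CMDiffAt ∞ (T% X) p) (hY : CMDiffAt ∞ (T% Y) p) :
    CMDiffAt ∞ (T% (mlieBracket 𝓘(ℝ, E) X Y)) p := by
  have : IsManifold 𝓘(ℝ, E) (minSmoothness ℝ 2) M := by
    rw [minSmoothness_of_isRCLikeNormedField]
    infer_instance
  have : IsManifold 𝓘(ℝ, E) (∞ + 1) M := inferInstanceAs (IsManifold 𝓘(ℝ, E) ∞ M)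
  exact ContMDiffAt.mlieBracket_vectorField (n := ⊤) (m := ⊤) hX hY (by simp)

theorem contMDiffAt_leviCivita {X Y : Π x : M, TangentSpace 𝓘(ℝ, E) x} {p : M}
    (hX : CMDiffAt ∞ (T% X) p) (hY : CMDiffAt ∞ (T% Y) p) :
    CMDiffAt ∞ (T% (fun x ↦ leviCivita Y x (X x))) p := by
  refine contMDiffAt_of_inner fun Z hZ ↦ ?_
  have hk : ContMDiffAt 𝓘(ℝ, E) 𝓘(ℝ, ℝ) ∞ (fun x ↦ (1 / 2 : ℝ) * koszul X Y Z x) p := by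
    refine contMDiffAt_const.mul ?_
    unfold koszul
    exact (((((contMDiffAt_mvfderiv_apply (contMDiffAt_inner hY hZ) hX).add
      (contMDiffAt_mvfderiv_apply (contMDiffAt_inner hX hZ) hY)).sub
      (contMDiffAt_mvfderiv_apply (contMDiffAt_inner hX hY) hZ)).add
      (contMDiffAt_inner (contMDiffAt_mlieBracket hX hY) hZ)).sub
      (contMDiffAt_inner (contMDiffAt_mlieBracket hX hZ) hY)).sub
      (contMDiffAt_inner (contMDiffAt_mlieBracket hY hZ) hX)
  refine hk.congr_of_eventuallyEq ?_
  filter_upwards [eventually_mdifferentiableAt hX, eventually_mdifferentiableAt hY,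
    eventually_mdifferentiableAt hZ] with x hx hy hz
  rw [← inner_leviCivita hx hy hz]
  ring

/-- The curvature tensor evaluated on vector fields. -/
def curvature (X Y Z : Π x : M, TangentSpace 𝓘(ℝ, E) x) (p : M) : TangentSpace 𝓘(ℝ, E) p :=
  leviCivita (fun x ↦ leviCivita Z x (Y x)) p (X p)
    - leviCivita (fun x ↦ leviCivita Z x (X x)) p (Y p)
    - leviCivita Z p (mlieBracket 𝓘(ℝ, E) X Y p)

theorem mvfderiv_mvfderiv_inner {X Y Z W : Π x : M, TangentSpace 𝓘(ℝ, E) x} {p : M}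
    (hX : CMDiffAt ∞ (T% X) p) (hY : CMDiffAt ∞ (T% Y) p)
    (hZ : CMDiffAt ∞ (T% Z) p) (hW : CMDiffAt ∞ (T% W) p) :
    mvfderiv 𝓘(ℝ, E) (fun x ↦ mvfderiv 𝓘(ℝ, E) (fun y ↦ (inner ℝ (Z y) (W y) : ℝ)) x (Y x)) p (X p)
      = inner ℝ (leviCivita (fun x ↦ leviCivita Z x (Y x)) p (X p)) (W p)
        + inner ℝ (leviCivita Z p (Y p)) (leviCivita W p (X p))
        + (inner ℝ (leviCivita Z p (X p)) (leviCivita W p (Y p))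
        + inner ℝ (Z p) (leviCivita (fun x ↦ leviCivita W x (Y x)) p (X p))) := by
  have md : ∀ {Z : Π x : M, TangentSpace 𝓘(ℝ, E) x}, CMDiffAt ∞ (T% Z) p → MDiffAt (T% Z) p :=
    fun h ↦ h.mdifferentiableAt (by simp)
  have hZY := contMDiffAt_leviCivita hY hZ
  have hWY := contMDiffAt_leviCivita hY hW
  have h1 : (fun x ↦ mvfderiv 𝓘(ℝ, E) (fun y ↦ (inner ℝ (Z y) (W y) : ℝ)) x (Y x)) =ᶠ[nhds p]
      fun x ↦ inner ℝ (leviCivita Z x (Y x)) (W x) + inner ℝ (Z x) (leviCivita W x (Y x)) := by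
    filter_upwards [eventually_mdifferentiableAt hY, eventually_mdifferentiableAt hZ,
      eventually_mdifferentiableAt hW] with x hy hz hw
    exact leviCivita_metric hy hz hw
  have h2 : mvfderiv 𝓘(ℝ, E)
      (fun x ↦ mvfderiv 𝓘(ℝ, E) (fun y ↦ (inner ℝ (Z y) (W y) : ℝ)) x (Y x)) p =
      mvfderiv 𝓘(ℝ, E) (fun x ↦ (inner ℝ (leviCivita Z x (Y x)) (W x) : ℝ)
        + inner ℝ (Z x) (leviCivita W x (Y x))) p :=
    h1.mfderiv_eq
  rw [h2, mvfderiv_fun_add (mdifferentiableAt_inner (md hZY) (md hW))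
    (mdifferentiableAt_inner (md hZ) (md hWY)), add_apply,
    leviCivita_metric (md hX) (md hZY) (md hW), leviCivita_metric (md hX) (md hZ) (md hWY)]

theorem inner_curvature_add {X Y Z W : Π x : M, TangentSpace 𝓘(ℝ, E) x} {p : M}
    (hX : CMDiffAt ∞ (T% X) p) (hY : CMDiffAt ∞ (T% Y) p)
    (hZ : CMDiffAt ∞ (T% Z) p) (hW : CMDiffAt ∞ (T% W) p) :
    (inner ℝ (curvature X Y Z p) (W p) : ℝ) + inner ℝ (Z p) (curvature X Y W p) = 0 := by
  have h1 := mvfderiv_mvfderiv_inner hX hY hZ hW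
  have h2 := mvfderiv_mvfderiv_inner hY hX hZ hW
  have h3 := mvfderiv_mlieBracket (contMDiffAt_inner hZ hW) hX hY
  rw [h1, h2, leviCivita_metric ((contMDiffAt_mlieBracket hX hY).mdifferentiableAt (by simp))
    (hZ.mdifferentiableAt (by simp)) (hW.mdifferentiableAt (by simp))] at h3
  simp only [curvature, inner_sub_left, inner_sub_right]
  linarith

/-- A surface with a nowhere vanishing parallel vector field is flat. -/
theorem isFlat_of_parallel (hdim : Module.finrank ℝ E = 2) {h : Π x : M, TangentSpace 𝓘(ℝ, E) x}
    (hs : ∀ p, CMDiffAt ∞ (T% h) p) (hpar : ∀ p, leviCivita h p = 0) (hne : ∀ p, h p ≠ 0) :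
    IsFlat E M := by
  intro X Y Z hX hY hZ p
  have hX' := hX p
  have hY' := hY p
  have hZ' := hZ p
  have hzero : curvature X Y h p = 0 := by
    have h1 : ∀ U : Π x : M, TangentSpace 𝓘(ℝ, E) x,
        leviCivita (fun x ↦ leviCivita h x (U x)) p = 0 := by
      intro U
      have h2 : (fun x ↦ leviCivita h x (U x)) = 0 := by
        funext x
        rw [hpar, zero_apply, Pi.zero_apply]
      rw [h2, CovariantDerivative.zero, Pi.zero_apply]
    rw [curvature, h1, h1, hpar]
    simp
  obtain ⟨w, -, hw⟩ := exists_orthogonal_complement_vector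
    (V := TangentSpace 𝓘(ℝ, E) p) hdim (hne p)
  have hW := contMDiffAt_extend (k := ∞) 𝓘(ℝ, E) E w
  have orth : ∀ {V : Π x : M, TangentSpace 𝓘(ℝ, E) x}, CMDiffAt ∞ (T% V) p →
      (inner ℝ (curvature X Y V p) (h p) : ℝ) = 0 := by
    intro V hV
    have := inner_curvature_add hX' hY' hV (hs p)
    rwa [hzero, inner_zero_right, add_zero] at this
  have hRW : curvature X Y (extend E w) p = 0 := by
    refine hw _ (orth hW) ?_
    have := inner_curvature_add hX' hY' hW hW
    rw [extend_apply_self, real_inner_comm w] at this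
    rw [real_inner_comm]
    linarith
  refine hw _ (orth hZ') ?_
  have := inner_curvature_add hX' hY' hZ' hW
  rwa [hRW, inner_zero_right, add_zero, extend_apply_self] at this

end LeviCivita

section Along

variable {E : Type*} [NormedAddCommGroup E] [NormedSpace ℝ E]
  {M : Type*} [TopologicalSpace M] [ChartedSpace E M]
  {E' : Type*} [NormedAddCommGroup E'] [NormedSpace ℝ E']
  {N : Type*} [TopologicalSpace N] [ChartedSpace E' N] [IsManifold 𝓘(ℝ, E') ∞ N]

variable (E) in
/-- The vector field `V` along `F` is smooth at `p`. -/
abbrev SmoothAlongAt (F : M → N) (V : Π x : M, TangentSpace 𝓘(ℝ, E') (F x)) (p : M) : Prop :=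
  ContMDiffAt 𝓘(ℝ, E) (𝓘(ℝ, E').prod 𝓘(ℝ, E')) ∞
    (fun x ↦ (⟨F x, V x⟩ : TangentBundle 𝓘(ℝ, E') N)) p

variable (E) in
/-- The vector field `V` along `F` is differentiable at `p`. -/
abbrev DiffAlongAt (F : M → N) (V : Π x : M, TangentSpace 𝓘(ℝ, E') (F x)) (p : M) : Prop :=
  MDifferentiableAt 𝓘(ℝ, E) (𝓘(ℝ, E').prod 𝓘(ℝ, E'))
    (fun x ↦ (⟨F x, V x⟩ : TangentBundle 𝓘(ℝ, E') N)) p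

/-- The coordinates of a vector field along `F` in the trivialization of the tangent bundle
around `q`. -/
def coordAlong (F : M → N) (q : N) (V : Π x : M, TangentSpace 𝓘(ℝ, E') (F x)) (x : M) : E' :=
  (trivializationAt E' (TangentSpace 𝓘(ℝ, E')) q ⟨F x, V x⟩).2

variable {F : M → N} {p : M}

theorem smoothAlongAt_iff {V : Π x : M, TangentSpace 𝓘(ℝ, E') (F x)} :
    SmoothAlongAt E F V p ↔ ContMDiffAt 𝓘(ℝ, E) 𝓘(ℝ, E') ∞ F p ∧
      ContMDiffAt 𝓘(ℝ, E) 𝓘(ℝ, E') ∞ (coordAlong F (F p) V) p :=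
  Bundle.contMDiffAt_totalSpace

theorem diffAlongAt_iff {V : Π x : M, TangentSpace 𝓘(ℝ, E') (F x)} :
    DiffAlongAt E F V p ↔ MDifferentiableAt 𝓘(ℝ, E) 𝓘(ℝ, E') F p ∧
      MDifferentiableAt 𝓘(ℝ, E) 𝓘(ℝ, E') (coordAlong F (F p) V) p :=
  mdifferentiableAt_totalSpace _ _

theorem SmoothAlongAt.diffAlongAt {V : Π x : M, TangentSpace 𝓘(ℝ, E') (F x)}
    (hV : SmoothAlongAt E F V p) : DiffAlongAt E F V p :=
  hV.mdifferentiableAt (by simp)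

theorem eventually_mem_baseSet (hF : ContinuousAt F p) :
    ∀ᶠ x in nhds p, F x ∈ (trivializationAt E' (TangentSpace 𝓘(ℝ, E')) (F p)).baseSet :=
  hF.eventually_mem ((trivializationAt E' (TangentSpace 𝓘(ℝ, E')) (F p)).open_baseSet.mem_nhds
    (FiberBundle.mem_baseSet_trivializationAt' (F := E') (E := TangentSpace 𝓘(ℝ, E')) (F p)))

theorem coordAlong_add (hF : ContinuousAt F p)
    (V V' : Π x : M, TangentSpace 𝓘(ℝ, E') (F x)) :
    coordAlong F (F p) (fun x ↦ V x + V' x) =ᶠ[nhds p]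
      coordAlong F (F p) V + coordAlong F (F p) V' := by
  filter_upwards [eventually_mem_baseSet (E' := E') hF] with x hx
  exact ((trivializationAt E' (TangentSpace 𝓘(ℝ, E')) (F p)).linear ℝ hx).map_add (V x) (V' x)

theorem coordAlong_smul (hF : ContinuousAt F p) (g : M → ℝ)
    (V : Π x : M, TangentSpace 𝓘(ℝ, E') (F x)) :
    coordAlong F (F p) (fun x ↦ g x • V x) =ᶠ[nhds p] g • coordAlong F (F p) V := by
  filter_upwards [eventually_mem_baseSet (E' := E') hF] with x hx
  exact ((trivializationAt E' (TangentSpace 𝓘(ℝ, E')) (F p)).linear ℝ hx).map_smul (g x) (V x)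

theorem SmoothAlongAt.contMDiffAt_base {V : Π x : M, TangentSpace 𝓘(ℝ, E') (F x)}
    (hV : SmoothAlongAt E F V p) : ContMDiffAt 𝓘(ℝ, E) 𝓘(ℝ, E') ∞ F p :=
  (smoothAlongAt_iff.1 hV).1

theorem SmoothAlongAt.add {V V' : Π x : M, TangentSpace 𝓘(ℝ, E') (F x)}
    (hV : SmoothAlongAt E F V p) (hV' : SmoothAlongAt E F V' p) :
    SmoothAlongAt E F (fun x ↦ V x + V' x) p := by
  obtain ⟨hF, h⟩ := smoothAlongAt_iff.1 hV
  exact smoothAlongAt_iff.2 ⟨hF, (h.add (smoothAlongAt_iff.1 hV').2).congr_of_eventuallyEq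
    (coordAlong_add hF.continuousAt V V')⟩

theorem SmoothAlongAt.smul {g : M → ℝ} {V : Π x : M, TangentSpace 𝓘(ℝ, E') (F x)}
    (hg : ContMDiffAt 𝓘(ℝ, E) 𝓘(ℝ, ℝ) ∞ g p) (hV : SmoothAlongAt E F V p) :
    SmoothAlongAt E F (fun x ↦ g x • V x) p := by
  obtain ⟨hF, h⟩ := smoothAlongAt_iff.1 hV
  exact smoothAlongAt_iff.2 ⟨hF, (hg.smul h).congr_of_eventuallyEq (coordAlong_smul hF.continuousAt g V)⟩

theorem SmoothAlongAt.congr {V V' : Π x : M, TangentSpace 𝓘(ℝ, E') (F x)}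
    (hV : SmoothAlongAt E F V p) (h : ∀ᶠ x in nhds p, V x = V' x) : SmoothAlongAt E F V' p := by
  refine ContMDiffAt.congr_of_eventuallyEq hV ?_
  filter_upwards [h] with x hx
  rw [hx]

theorem smoothAlongAt_comp (hF : ContMDiffAt 𝓘(ℝ, E) 𝓘(ℝ, E') ∞ F p)
    {W : Π y : N, TangentSpace 𝓘(ℝ, E') y} (hW : CMDiffAt ∞ (T% W) (F p)) :
    SmoothAlongAt E F (fun x ↦ W (F x)) p :=
  ContMDiffAt.comp p hW hF

theorem SmoothAlongAt.sub {V V' : Π x : M, TangentSpace 𝓘(ℝ, E') (F x)}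
    (hV : SmoothAlongAt E F V p) (hV' : SmoothAlongAt E F V' p) :
    SmoothAlongAt E F (fun x ↦ V x - V' x) p := by
  refine (hV.add (hV'.smul (contMDiffAt_const (c := (-1 : ℝ))))).congr (.of_forall fun x ↦ ?_)
  simp [sub_eq_add_neg]

variable [FiniteDimensional ℝ E']

/-- To prove a local property of the vector fields along `F`, it suffices to prove it for the
restrictions of the vector fields of `N`, and to show that it is stable under sums and under
products with functions. -/
theorem SmoothAlongAt.induction {P : (Π x : M, TangentSpace 𝓘(ℝ, E') (F x)) → Prop}
    (comp : ∀ W : Π y : N, TangentSpace 𝓘(ℝ, E') y, CMDiffAt ∞ (T% W) (F p) →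
      P (fun x ↦ W (F x)))
    (add : ∀ V V', SmoothAlongAt E F V p → SmoothAlongAt E F V' p → P V → P V' →
      P (fun x ↦ V x + V' x))
    (smul : ∀ (g : M → ℝ) V, ContMDiffAt 𝓘(ℝ, E) 𝓘(ℝ, ℝ) ∞ g p → SmoothAlongAt E F V p → P V →
      P (fun x ↦ g x • V x))
    (congr : ∀ V V', SmoothAlongAt E F V p → (∀ᶠ x in nhds p, V x = V' x) → P V → P V')
    {V : Π x : M, TangentSpace 𝓘(ℝ, E') (F x)} (hV : SmoothAlongAt E F V p) : P V := by
  classical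
  obtain ⟨hF, hc⟩ := smoothAlongAt_iff.1 hV
  set e := trivializationAt E' (TangentSpace 𝓘(ℝ, E')) (F p)
  have hp : F p ∈ e.baseSet := FiberBundle.mem_baseSet_trivializationAt' (F p)
  let b := Module.finBasis ℝ E'
  have hw : ∀ i, CMDiffAt ∞ (T% (e.localFrame b i)) (F p) := fun i ↦
    contMDiffAt_localFrame_of_mem (I := 𝓘(ℝ, E')) ∞ e b i hp
  let c : Fin (Module.finrank ℝ E') → M → ℝ := fun i x ↦ b.coord i (coordAlong F (F p) V x)
  have hcs : ∀ i, ContMDiffAt 𝓘(ℝ, E) 𝓘(ℝ, ℝ) ∞ (c i) p := fun i ↦ by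
    have h1 : ContMDiffAt 𝓘(ℝ, E') 𝓘(ℝ, ℝ) ∞ (LinearMap.toContinuousLinearMap (b.coord i))
      (coordAlong F (F p) V p) := (ContinuousLinearMap.contDiff _).contDiffAt.contMDiffAt
    exact h1.comp p hc
  have hsum : ∀ s : Finset (Fin (Module.finrank ℝ E')),
      SmoothAlongAt E F (fun x ↦ ∑ i ∈ s, c i x • e.localFrame b i (F x)) p ∧
        P (fun x ↦ ∑ i ∈ s, c i x • e.localFrame b i (F x)) := by
    intro s
    induction s using Finset.induction_on with
    | empty =>
      have h0 : CMDiffAt ∞ (T% (0 : Π y : N, TangentSpace 𝓘(ℝ, E') y)) (F p) :=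
        (contMDiff_zeroSection ℝ (TangentSpace 𝓘(ℝ, E') : N → Type _)).contMDiffAt
      simp only [Finset.sum_empty]
      exact ⟨smoothAlongAt_comp hF h0, comp _ h0⟩
    | insert i s hi ih =>
      have h1 := smoothAlongAt_comp hF (hw i)
      have h2 := h1.smul (hcs i)
      simp only [Finset.sum_insert hi]
      exact ⟨h2.add ih.1, add _ _ h2 ih.1 (smul _ _ (hcs i) h1 (comp _ (hw i))) ih.2⟩
  refine congr _ _ (hsum Finset.univ).1 ?_ (hsum Finset.univ).2
  filter_upwards [eventually_mem_baseSet (E' := E') hF.continuousAt] with x hx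
  have h1 := e.eq_sum_localFrameCoeff_smul (I := 𝓘(ℝ, E')) (b := b) (s := extend E' (V x)) hx
  rw [extend_apply_self] at h1
  refine Eq.trans (Finset.sum_congr rfl fun i _ ↦ ?_) h1.symm
  have h2 := e.localFrameCoeff_eq_coeff (I := 𝓘(ℝ, E')) (b := b) (s := extend E' (V x)) hx (i := i)
  change _ = b.repr (e ⟨F x, extend E' (V x) (F x)⟩).2 i at h2
  rw [extend_apply_self] at h2
  rw [h2]
  rfl

end Along

section CovAlong

variable {E : Type*} [NormedAddCommGroup E] [NormedSpace ℝ E]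
  {M : Type*} [TopologicalSpace M] [ChartedSpace E M]
  {E' : Type*} [NormedAddCommGroup E'] [NormedSpace ℝ E'] [FiniteDimensional ℝ E']
  {N : Type*} [TopologicalSpace N] [ChartedSpace E' N] [IsManifold 𝓘(ℝ, E') ∞ N]
  [RiemannianBundle (fun y : N ↦ TangentSpace 𝓘(ℝ, E') y)]
  [IsContMDiffRiemannianBundle 𝓘(ℝ, E') ∞ E' (fun y : N ↦ TangentSpace 𝓘(ℝ, E') y)]
  {F : M → N} {p : M}

theorem leviCivita_extend_add {q : N} (v w : TangentSpace 𝓘(ℝ, E') q) :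
    leviCivita (extend E' (v + w)) q =
      leviCivita (extend E' v) q + leviCivita (extend E' w) q := by
  set e := trivializationAt E' (TangentSpace 𝓘(ℝ, E')) q
  have hq : q ∈ e.baseSet := FiberBundle.mem_baseSet_trivializationAt' q
  have hv := mdifferentiableAt_extend 𝓘(ℝ, E') E' v
  have hw := mdifferentiableAt_extend 𝓘(ℝ, E') E' w
  rw [← leviCivita.isCovariantDerivativeOn.add hv hw]
  refine leviCivita.isCovariantDerivativeOn.congr_of_eventuallyEq (s := Set.univ)
    (mdifferentiableAt_extend 𝓘(ℝ, E') E' _) (mdifferentiableAt_add_section hv hw)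
    Filter.univ_mem ?_
  filter_upwards [e.open_baseSet.mem_nhds hq] with y hy
  have h1 : (e ⟨q, v + w⟩).2 = (e ⟨q, v⟩).2 + (e ⟨q, w⟩).2 := (e.linear ℝ hq).map_add v w
  have h2 := (e.symmₗ ℝ y).map_add (e ⟨q, v⟩).2 (e ⟨q, w⟩).2
  rw [← h1, e.coe_symmₗ hy] at h2
  exact h2

theorem leviCivita_extend_smul {q : N} (a : ℝ) (v : TangentSpace 𝓘(ℝ, E') q) :
    leviCivita (extend E' (a • v)) q = a • leviCivita (extend E' v) q := by
  set e := trivializationAt E' (TangentSpace 𝓘(ℝ, E')) q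
  have hq : q ∈ e.baseSet := FiberBundle.mem_baseSet_trivializationAt' q
  have hv := mdifferentiableAt_extend 𝓘(ℝ, E') E' v
  rw [← leviCivita.isCovariantDerivativeOn.smul_const a hv]
  refine leviCivita.isCovariantDerivativeOn.congr_of_eventuallyEq (s := Set.univ)
    (mdifferentiableAt_extend 𝓘(ℝ, E') E' _) (mdifferentiableAt_const.smul_section hv)
    Filter.univ_mem ?_
  filter_upwards [e.open_baseSet.mem_nhds hq] with y hy
  have h1 : (e ⟨q, a • v⟩).2 = a • (e ⟨q, v⟩).2 := (e.linear ℝ hq).map_smul a v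
  have h2 := (e.symmₗ ℝ y).map_smul a (e ⟨q, v⟩).2
  rw [← h1, e.coe_symmₗ hy] at h2
  exact h2

theorem covAlong_apply (V : Π x : M, TangentSpace 𝓘(ℝ, E') (F x)) (u : TangentSpace 𝓘(ℝ, E) p) :
    covAlong E E' F V p u =
      (trivializationAt E' (TangentSpace 𝓘(ℝ, E')) (F p)).symmL ℝ (F p)
        (mvfderiv 𝓘(ℝ, E) (coordAlong F (F p) V) p u)
      + leviCivita (extend E' (V p)) (F p) (mfderiv 𝓘(ℝ, E) 𝓘(ℝ, E') F p u) := rfl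

theorem covAlong_congr {V V' : Π x : M, TangentSpace 𝓘(ℝ, E') (F x)}
    (h : ∀ᶠ x in nhds p, V x = V' x) : covAlong E E' F V p = covAlong E E' F V' p := by
  ext u
  have h1 : coordAlong F (F p) V =ᶠ[nhds p] coordAlong F (F p) V' := by
    filter_upwards [h] with x hx
    rw [coordAlong, coordAlong, hx]
  have h2 : mvfderiv 𝓘(ℝ, E) (coordAlong F (F p) V) p =
    mvfderiv 𝓘(ℝ, E) (coordAlong F (F p) V') p := by
    ext v
    have h3 := h1.mfderiv_eq (I := 𝓘(ℝ, E)) (I' := 𝓘(ℝ, E'))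
    exact congrArg (fun L : E →L[ℝ] E' ↦ L v) h3
  rw [covAlong_apply, covAlong_apply, h2, h.self_of_nhds]

theorem covAlong_add {V V' : Π x : M, TangentSpace 𝓘(ℝ, E') (F x)}
    (hV : DiffAlongAt E F V p) (hV' : DiffAlongAt E F V' p) (u : TangentSpace 𝓘(ℝ, E) p) :
    covAlong E E' F (fun x ↦ V x + V' x) p u =
      covAlong E E' F V p u + covAlong E E' F V' p u := by
  obtain ⟨hF, h⟩ := diffAlongAt_iff.1 hV
  have h' := (diffAlongAt_iff.1 hV').2
  have h2 : mvfderiv 𝓘(ℝ, E) (coordAlong F (F p) (fun x ↦ V x + V' x)) p u =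
      mvfderiv 𝓘(ℝ, E) (coordAlong F (F p) V) p u
        + mvfderiv 𝓘(ℝ, E) (coordAlong F (F p) V') p u := by
    rw [← add_apply, ← mvfderiv_add h h']
    have h3 := (coordAlong_add hF.continuousAt V V').mfderiv_eq (I := 𝓘(ℝ, E)) (I' := 𝓘(ℝ, E'))
    exact congrArg (fun L : E →L[ℝ] E' ↦ L u) h3
  simp only [covAlong_apply]
  rw [h2, leviCivita_extend_add, map_add, add_apply]
  abel

theorem covAlong_smul {g : M → ℝ} {V : Π x : M, TangentSpace 𝓘(ℝ, E') (F x)}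
    (hg : MDifferentiableAt 𝓘(ℝ, E) 𝓘(ℝ, ℝ) g p) (hV : DiffAlongAt E F V p)
    (u : TangentSpace 𝓘(ℝ, E) p) :
    covAlong E E' F (fun x ↦ g x • V x) p u =
      g p • covAlong E E' F V p u + mvfderiv 𝓘(ℝ, E) g p u • V p := by
  obtain ⟨hF, h⟩ := diffAlongAt_iff.1 hV
  have hq := FiberBundle.mem_baseSet_trivializationAt' (F := E') (E := TangentSpace 𝓘(ℝ, E')) (F p)
  have h2 : mvfderiv 𝓘(ℝ, E) (coordAlong F (F p) (fun x ↦ g x • V x)) p u =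
      g p • mvfderiv 𝓘(ℝ, E) (coordAlong F (F p) V) p u
        + mvfderiv 𝓘(ℝ, E) g p u • coordAlong F (F p) V p := by
    have h4 := mvfderiv_smul hg h
    have h3 := (coordAlong_smul hF.continuousAt g V).mfderiv_eq (I := 𝓘(ℝ, E)) (I' := 𝓘(ℝ, E'))
    refine (congrArg (fun L : E →L[ℝ] E' ↦ L u) h3).trans ?_
    exact congrArg (fun L : E →L[ℝ] E' ↦ L u) h4
  have h5 : (trivializationAt E' (TangentSpace 𝓘(ℝ, E')) (F p)).symmL ℝ (F p)
      (coordAlong F (F p) V p) = V p := by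
    have := (trivializationAt E' (TangentSpace 𝓘(ℝ, E')) (F p)).symmL_continuousLinearMapAt
      (R := ℝ) hq (V p)
    rwa [(trivializationAt E' (TangentSpace 𝓘(ℝ, E')) (F p)).continuousLinearMapAt_apply_of_mem ℝ hq]
      at this
  simp only [covAlong_apply]
  rw [h2, leviCivita_extend_smul, map_add, map_smul, map_smul, h5, smul_apply, smul_add]
  abel

variable [FiniteDimensional ℝ E] [IsManifold 𝓘(ℝ, E) ∞ M]
  [RiemannianBundle (fun x : M ↦ TangentSpace 𝓘(ℝ, E) x)]

theorem covAlong_comp_apply (hF : MDifferentiableAt 𝓘(ℝ, E) 𝓘(ℝ, E') F p)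
    {W : Π y : N, TangentSpace 𝓘(ℝ, E') y} (hW : MDiffAt (T% W) (F p))
    (u : TangentSpace 𝓘(ℝ, E) p) :
    covAlong E E' F (fun x ↦ W (F x)) p u =
      leviCivita W (F p) (mfderiv 𝓘(ℝ, E) 𝓘(ℝ, E') F p u) := by
  rw [covAlong_comp E E' F p hF W hW]
  rfl

theorem smoothAlongAt_inner {V V' : Π x : M, TangentSpace 𝓘(ℝ, E') (F x)}
    (hV : SmoothAlongAt E F V p) (hV' : SmoothAlongAt E F V' p) :
    ContMDiffAt 𝓘(ℝ, E) 𝓘(ℝ, ℝ) ∞ (fun x ↦ (inner ℝ (V x) (V' x) : ℝ)) p :=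
  ContMDiffAt.inner_bundle (F := E') (E := fun y : N ↦ TangentSpace 𝓘(ℝ, E') y) hV hV'

theorem covAlong_metric {V V' : Π x : M, TangentSpace 𝓘(ℝ, E') (F x)}
    (hV : SmoothAlongAt E F V p) (hV' : SmoothAlongAt E F V' p) (u : TangentSpace 𝓘(ℝ, E) p) :
    mvfderiv 𝓘(ℝ, E) (fun x ↦ (inner ℝ (V x) (V' x) : ℝ)) p u =
      inner ℝ (covAlong E E' F V p u) (V' p) + inner ℝ (V p) (covAlong E E' F V' p u) := by
  have hF := hV.contMDiffAt_base
  let Q : (Π x : M, TangentSpace 𝓘(ℝ, E') (F x)) → (Π x : M, TangentSpace 𝓘(ℝ, E') (F x)) → Prop :=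
    fun V V' ↦ mvfderiv 𝓘(ℝ, E) (fun x ↦ (inner ℝ (V x) (V' x) : ℝ)) p u =
      inner ℝ (covAlong E E' F V p u) (V' p) + inner ℝ (V p) (covAlong E E' F V' p u)
  have md : ∀ {V V' : Π x : M, TangentSpace 𝓘(ℝ, E') (F x)}, SmoothAlongAt E F V p →
      SmoothAlongAt E F V' p → MDifferentiableAt 𝓘(ℝ, E) 𝓘(ℝ, ℝ)
        (fun x ↦ (inner ℝ (V x) (V' x) : ℝ)) p :=
    fun h h' ↦ (smoothAlongAt_inner h h').mdifferentiableAt (by simp)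
  have symm : ∀ V V', Q V V' → Q V' V := by
    intro V V' h
    have h' : mvfderiv 𝓘(ℝ, E) (fun x ↦ (inner ℝ (V x) (V' x) : ℝ)) p u =
      inner ℝ (covAlong E E' F V p u) (V' p) + inner ℝ (V p) (covAlong E E' F V' p u) := h
    change mvfderiv 𝓘(ℝ, E) (fun x ↦ (inner ℝ (V' x) (V x) : ℝ)) p u =
      inner ℝ (covAlong E E' F V' p u) (V p) + inner ℝ (V' p) (covAlong E E' F V p u)
    simp only [real_inner_comm (V _) (V' _)] at h' ⊢
    rw [h', real_inner_comm (V p), real_inner_comm (V' p), add_comm]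
  have step : ∀ {V'}, SmoothAlongAt E F V' p →
      (∀ W : Π y : N, TangentSpace 𝓘(ℝ, E') y, CMDiffAt ∞ (T% W) (F p) →
        Q (fun x ↦ W (F x)) V') → ∀ {V}, SmoothAlongAt E F V p → Q V V' := by
    intro V' hV' hcomp V hV
    refine SmoothAlongAt.induction (P := fun V ↦ Q V V') hcomp ?_ ?_ ?_ hV
    · intro V₁ V₂ h₁ h₂ q₁ q₂
      have q₁' : mvfderiv 𝓘(ℝ, E) (fun x ↦ (inner ℝ (V₁ x) (V' x) : ℝ)) p u = _ := q₁
      have q₂' : mvfderiv 𝓘(ℝ, E) (fun x ↦ (inner ℝ (V₂ x) (V' x) : ℝ)) p u = _ := q₂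
      change mvfderiv 𝓘(ℝ, E) (fun x ↦ (inner ℝ (V₁ x + V₂ x) (V' x) : ℝ)) p u = _
      simp only [inner_add_left]
      rw [mvfderiv_fun_add (md h₁ hV') (md h₂ hV'), add_apply, q₁', q₂', covAlong_add h₁.diffAlongAt h₂.diffAlongAt,
        inner_add_left]
      abel
    · intro g V₁ hg h₁ q₁
      have q₁' : mvfderiv 𝓘(ℝ, E) (fun x ↦ (inner ℝ (V₁ x) (V' x) : ℝ)) p u = _ := q₁
      change mvfderiv 𝓘(ℝ, E) (fun x ↦ (inner ℝ (g x • V₁ x) (V' x) : ℝ)) p u = _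
      simp only [real_inner_smul_left]
      rw [mvfderiv_fun_mul (hg.mdifferentiableAt (by simp)) (md h₁ hV'), add_apply, smul_apply,
        smul_apply, q₁', covAlong_smul (hg.mdifferentiableAt (by simp)) h₁.diffAlongAt, inner_add_left, real_inner_smul_left,
        real_inner_smul_left, smul_eq_mul, smul_eq_mul]
      ring
    · intro V₁ V₂ h₁ h q₁
      have q₁' : mvfderiv 𝓘(ℝ, E) (fun x ↦ (inner ℝ (V₁ x) (V' x) : ℝ)) p u = _ := q₁
      have h3 : (fun x ↦ (inner ℝ (V₂ x) (V' x) : ℝ)) =ᶠ[nhds p]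
          fun x ↦ (inner ℝ (V₁ x) (V' x) : ℝ) := by
        filter_upwards [h] with x hx
        rw [hx]
      have h4 : mvfderiv 𝓘(ℝ, E) (fun x ↦ (inner ℝ (V₂ x) (V' x) : ℝ)) p =
        mvfderiv 𝓘(ℝ, E) (fun x ↦ (inner ℝ (V₁ x) (V' x) : ℝ)) p := h3.mfderiv_eq
      change mvfderiv 𝓘(ℝ, E) (fun x ↦ (inner ℝ (V₂ x) (V' x) : ℝ)) p u = _
      rw [h4, q₁', covAlong_congr h, h.self_of_nhds]
  refine step hV' (fun W hW ↦ symm _ _ (step (smoothAlongAt_comp hF hW) (fun W' hW' ↦ ?_) hV')) hV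
  change mvfderiv 𝓘(ℝ, E) ((fun y ↦ (inner ℝ (W' y) (W y) : ℝ)) ∘ F) p u =
    inner ℝ (covAlong E E' F (fun x ↦ W' (F x)) p u) (W (F p))
      + inner ℝ (W' (F p)) (covAlong E E' F (fun x ↦ W (F x)) p u)
  have hX := mdifferentiableAt_extend 𝓘(ℝ, E') E' (mfderiv 𝓘(ℝ, E) 𝓘(ℝ, E') F p u)
  have h1 := leviCivita_metric hX (hW'.mdifferentiableAt (by simp))
    (hW.mdifferentiableAt (by simp))
  rw [extend_apply_self] at h1
  rw [covAlong_comp_apply (hF.mdifferentiableAt (by simp)) (hW.mdifferentiableAt (by simp)),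
    covAlong_comp_apply (hF.mdifferentiableAt (by simp)) (hW'.mdifferentiableAt (by simp)), ← h1]
  exact mvfderiv_comp_apply p ((contMDiffAt_inner hW' hW).mdifferentiableAt (by simp))
    (hF.mdifferentiableAt (by simp)) u

theorem smoothAlongAt_leviCivita {W : Π y : N, TangentSpace 𝓘(ℝ, E') y}
    (hW : CMDiffAt ∞ (T% W) (F p)) {U : Π x : M, TangentSpace 𝓘(ℝ, E') (F x)}
    (hU : SmoothAlongAt E F U p) : SmoothAlongAt E F (fun x ↦ leviCivita W (F x) (U x)) p := by
  refine SmoothAlongAt.induction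
    (P := fun U ↦ SmoothAlongAt E F (fun x ↦ leviCivita W (F x) (U x)) p)
    (fun W' hW' ↦ ?_) (fun V V' _ _ h h' ↦ ?_) (fun g V hg _ h ↦ ?_) (fun V V' _ h h' ↦ ?_) hU
  · exact smoothAlongAt_comp hU.contMDiffAt_base (contMDiffAt_leviCivita hW' hW)
  · simp only [map_add]
    exact h.add h'
  · simp only [map_smul]
    exact h.smul hg
  · refine h'.congr ?_
    filter_upwards [h] with x hx
    rw [hx]

theorem smoothAlongAt_covAlong {V : Π x : M, TangentSpace 𝓘(ℝ, E') (F x)}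
    (hV : SmoothAlongAt E F V p) {X : Π x : M, TangentSpace 𝓘(ℝ, E) x}
    (hX : CMDiffAt ∞ (T% X) p) :
    SmoothAlongAt E F (fun x ↦ covAlong E E' F V x (X x)) p := by
  have hF := hV.contMDiffAt_base
  refine SmoothAlongAt.induction
    (P := fun V ↦ SmoothAlongAt E F (fun x ↦ covAlong E E' F V x (X x)) p)
    (fun W hW ↦ ?_) (fun V V' hV hV' h h' ↦ ?_) (fun g V hg hV h ↦ ?_) (fun V V' _ h h' ↦ ?_) hV
  · refine (smoothAlongAt_leviCivita hW (contMDiffAt_mfderiv_apply hF hX)).congr ?_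
    filter_upwards [eventually_mdifferentiableAt hF,
      hF.continuousAt.eventually (eventually_mdifferentiableAt hW)] with x hx hx'
    exact (covAlong_comp_apply hx hx' (X x)).symm
  · refine (h.add h').congr ?_
    filter_upwards [eventually_mdifferentiableAt hV, eventually_mdifferentiableAt hV'] with x hx hx'
    exact (covAlong_add hx hx' (X x)).symm
  · refine ((h.smul hg).add (hV.smul (contMDiffAt_mvfderiv_apply hg hX))).congr ?_
    filter_upwards [eventually_mdifferentiableAt hg, eventually_mdifferentiableAt hV] with x hx hx'
    exact (covAlong_smul hx hx' (X x)).symm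
  · refine h'.congr ?_
    filter_upwards [h.eventually_nhds] with x hx
    rw [covAlong_congr hx]

variable {J : Π y : N, TangentSpace 𝓘(ℝ, E') y →L[ℝ] TangentSpace 𝓘(ℝ, E') y}

theorem IsKahler.smoothAlongAt (hJ : IsKahler J) {V : Π x : M, TangentSpace 𝓘(ℝ, E') (F x)}
    (hV : SmoothAlongAt E F V p) : SmoothAlongAt E F (fun x ↦ J (F x) (V x)) p :=
  ContMDiffAt.clm_bundle_apply (F₁ := E') (F₂ := E')
    (E₁ := fun y : N ↦ TangentSpace 𝓘(ℝ, E') y) (E₂ := fun y : N ↦ TangentSpace 𝓘(ℝ, E') y)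
    (b := F) (ϕ := fun x ↦ J (F x)) (hJ.contMDiff.contMDiffAt.comp p hV.contMDiffAt_base) hV

theorem IsKahler.covAlong (hJ : IsKahler J) {V : Π x : M, TangentSpace 𝓘(ℝ, E') (F x)}
    (hV : SmoothAlongAt E F V p) (u : TangentSpace 𝓘(ℝ, E) p) :
    covAlong E E' F (fun x ↦ J (F x) (V x)) p u = J (F p) (TotReal.covAlong E E' F V p u) := by
  have hF := hV.contMDiffAt_base
  refine SmoothAlongAt.induction
    (P := fun V ↦ TotReal.covAlong E E' F (fun x ↦ J (F x) (V x)) p u =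
      J (F p) (TotReal.covAlong E E' F V p u))
    (fun W hW ↦ ?_) (fun V V' hV hV' h h' ↦ ?_) (fun g V hg hV h ↦ ?_) (fun V V' _ h h' ↦ ?_) hV
  · have hF' : MDifferentiableAt 𝓘(ℝ, E) 𝓘(ℝ, E') F p := hF.mdifferentiableAt (by simp)
    have hW' : MDiffAt (T% W) (F p) := hW.mdifferentiableAt (by simp)
    have hJW : MDiffAt (T% (fun y ↦ J y (W y))) (F p) :=
      (ContMDiffAt.clm_bundle_apply (F₁ := E') (F₂ := E')
        (E₁ := fun y : N ↦ TangentSpace 𝓘(ℝ, E') y) (E₂ := fun y : N ↦ TangentSpace 𝓘(ℝ, E') y)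
        (b := fun y ↦ y) (ϕ := fun y ↦ J y) hJ.contMDiff.contMDiffAt hW).mdifferentiableAt (by simp)
    rw [covAlong_comp_apply hF' hW', ← hJ.parallel _ _ hW']
    exact covAlong_comp_apply (W := fun y ↦ J y (W y)) hF' hJW u
  · simp only [map_add]
    rw [covAlong_add (hJ.smoothAlongAt hV).diffAlongAt (hJ.smoothAlongAt hV').diffAlongAt, h, h',
      covAlong_add hV.diffAlongAt hV'.diffAlongAt, map_add]
  · simp only [map_smul]
    have hg' : MDifferentiableAt 𝓘(ℝ, E) 𝓘(ℝ, ℝ) g p := hg.mdifferentiableAt (by simp)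
    rw [covAlong_smul hg' (hJ.smoothAlongAt hV).diffAlongAt, h, covAlong_smul hg' hV.diffAlongAt,
      map_add, map_smul, map_smul]
  · have h1 : TotReal.covAlong E E' F (fun x ↦ J (F x) (V' x)) p =
        TotReal.covAlong E E' F (fun x ↦ J (F x) (V x)) p := by
      refine covAlong_congr ?_
      filter_upwards [h] with x hx
      rw [hx]
    rw [h1, h', covAlong_congr h]

/-- The coordinates of a tangent vector in the trivialization around `q` are given by the
derivative of the chart at `q`. -/
theorem trivializationAt_snd_eq {q y : N} (hy : y ∈ (chartAt E' q).source)
    (v : TangentSpace 𝓘(ℝ, E') y) :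
    (trivializationAt E' (TangentSpace 𝓘(ℝ, E')) q ⟨y, v⟩).2 =
      mvfderiv 𝓘(ℝ, E') (extChartAt 𝓘(ℝ, E') q) y v := by
  have h1 := TangentBundle.continuousLinearMapAt_trivializationAt (I := 𝓘(ℝ, E')) hy
  have h2 := congrArg (fun L : E' →L[ℝ] E' ↦ L v) h1
  have hy' : y ∈ (trivializationAt E' (TangentSpace 𝓘(ℝ, E')) q).baseSet := hy
  refine Eq.trans ?_ h2
  exact ((trivializationAt E' (TangentSpace 𝓘(ℝ, E')) q).continuousLinearMapAt_apply_of_mem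
    ℝ hy' v).symm

theorem mlieBracket_extend {q : N} (v w : TangentSpace 𝓘(ℝ, E') q) :
    mlieBracket 𝓘(ℝ, E') (extend E' v) (extend E' w) q = 0 := by
  have hφ : ContMDiffAt 𝓘(ℝ, E') 𝓘(ℝ, E') ∞ (extChartAt 𝓘(ℝ, E') q) q := contMDiffAt_extChartAt
  have h1 := mvfderiv_mlieBracket hφ (contMDiffAt_extend (k := ∞) 𝓘(ℝ, E') E' v)
    (contMDiffAt_extend (k := ∞) 𝓘(ℝ, E') E' w)
  have h2 : ∀ v : TangentSpace 𝓘(ℝ, E') q,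
      mvfderiv 𝓘(ℝ, E') (fun y ↦ mvfderiv 𝓘(ℝ, E') (extChartAt 𝓘(ℝ, E') q) y (extend E' v y)) q
        = 0 := by
    intro v
    have h3 : (fun y ↦ mvfderiv 𝓘(ℝ, E') (extChartAt 𝓘(ℝ, E') q) y (extend E' v y)) =ᶠ[nhds q]
        fun _ ↦ (trivializationAt E' (TangentSpace 𝓘(ℝ, E')) q ⟨q, v⟩).2 := by
      filter_upwards [chart_source_mem_nhds E' q] with y hy
      rw [← trivializationAt_snd_eq hy]
      have h4 := congrArg Prod.snd
        ((trivializationAt E' (TangentSpace 𝓘(ℝ, E')) q).apply_mk_symm hy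
          (trivializationAt E' (TangentSpace 𝓘(ℝ, E')) q ⟨q, v⟩).2)
      exact h4
    rw [mvfderiv_congr E' h3, mvfderiv_const]
  rw [h2, h2, zero_apply, zero_apply, sub_zero] at h1
  have h4 := (isInvertible_mfderiv_extChartAt (I := 𝓘(ℝ, E')) (mem_extChartAt_source q)).injective
  exact h4 (Eq.trans h1 (map_zero _).symm)

theorem covAlong_mfderiv_sub (hF : ContMDiffAt 𝓘(ℝ, E) 𝓘(ℝ, E') ∞ F p)
    {X Y : Π x : M, TangentSpace 𝓘(ℝ, E) x} (hX : CMDiffAt ∞ (T% X) p)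
    (hY : CMDiffAt ∞ (T% Y) p) :
    covAlong E E' F (fun x ↦ mfderiv 𝓘(ℝ, E) 𝓘(ℝ, E') F x (Y x)) p (X p)
      - covAlong E E' F (fun x ↦ mfderiv 𝓘(ℝ, E) 𝓘(ℝ, E') F x (X x)) p (Y p)
      = mfderiv 𝓘(ℝ, E) 𝓘(ℝ, E') F p (mlieBracket 𝓘(ℝ, E) X Y p) := by
  set φ := extChartAt 𝓘(ℝ, E') (F p)
  set e := trivializationAt E' (TangentSpace 𝓘(ℝ, E')) (F p)
  have hq : F p ∈ e.baseSet := FiberBundle.mem_baseSet_trivializationAt' (F p)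
  have hφ : ContMDiffAt 𝓘(ℝ, E') 𝓘(ℝ, E') ∞ φ (F p) := contMDiffAt_extChartAt
  have hφF : ContMDiffAt 𝓘(ℝ, E) 𝓘(ℝ, E') ∞ (φ ∘ F) p := hφ.comp p hF
  have coord : ∀ Z : Π x : M, TangentSpace 𝓘(ℝ, E) x, ∀ᶠ x in nhds p,
      coordAlong F (F p) (fun x ↦ mfderiv 𝓘(ℝ, E) 𝓘(ℝ, E') F x (Z x)) x =
        mvfderiv 𝓘(ℝ, E) (φ ∘ F) x (Z x) := by
    intro Z
    filter_upwards [eventually_mdifferentiableAt hF,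
      hF.continuousAt.eventually (chart_source_mem_nhds E' (F p))] with x hx hx'
    rw [coordAlong, trivializationAt_snd_eq hx']
    exact (mfderiv_comp_apply x (mdifferentiableAt_extChartAt hx') hx (Z x)).symm
  have dcoord : ∀ Z : Π x : M, TangentSpace 𝓘(ℝ, E) x, ∀ u : TangentSpace 𝓘(ℝ, E) p,
      mvfderiv 𝓘(ℝ, E) (coordAlong F (F p) (fun x ↦ mfderiv 𝓘(ℝ, E) 𝓘(ℝ, E') F x (Z x))) p u =
        mvfderiv 𝓘(ℝ, E) (fun x ↦ mvfderiv 𝓘(ℝ, E) (φ ∘ F) x (Z x)) p u := by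
    intro Z u
    have h3 := Filter.EventuallyEq.mfderiv_eq (I := 𝓘(ℝ, E)) (I' := 𝓘(ℝ, E')) (coord Z)
    exact congrArg (fun L : E →L[ℝ] E' ↦ L u) h3
  have h1 := mvfderiv_mlieBracket hφF hX hY
  have h2 := leviCivita_torsion
    (mdifferentiableAt_extend 𝓘(ℝ, E') E' (mfderiv 𝓘(ℝ, E) 𝓘(ℝ, E') F p (X p)))
    (mdifferentiableAt_extend 𝓘(ℝ, E') E' (mfderiv 𝓘(ℝ, E) 𝓘(ℝ, E') F p (Y p)))
  rw [mlieBracket_extend, extend_apply_self, extend_apply_self] at h2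
  have h3 : e.symmL ℝ (F p) (mvfderiv 𝓘(ℝ, E) (φ ∘ F) p (mlieBracket 𝓘(ℝ, E) X Y p)) =
      mfderiv 𝓘(ℝ, E) 𝓘(ℝ, E') F p (mlieBracket 𝓘(ℝ, E) X Y p) := by
    have h4 := (coord (mlieBracket 𝓘(ℝ, E) X Y)).self_of_nhds
    rw [← h4]
    have := e.symmL_continuousLinearMapAt (R := ℝ) hq
      (mfderiv 𝓘(ℝ, E) 𝓘(ℝ, E') F p (mlieBracket 𝓘(ℝ, E) X Y p))
    rwa [e.continuousLinearMapAt_apply_of_mem ℝ hq] at this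
  rw [covAlong_apply, covAlong_apply, dcoord, dcoord, add_sub_add_comm, h2, add_zero, ← map_sub,
    ← h1]
  exact h3

end CovAlong

section Plane

/-- On a Euclidean plane, a totally symmetric trace-free trilinear form whose associated
endomorphisms commute vanishes. -/
theorem eq_zero_of_symmetric_of_commute {V : Type*} [NormedAddCommGroup V] [InnerProductSpace ℝ V]
    [FiniteDimensional ℝ V] (hV : Module.finrank ℝ V = 2) (S : V →ₗ[ℝ] V →ₗ[ℝ] V)
    (hS : ∀ u v, S u v = S v u) (hS' : ∀ u v w, (inner ℝ (S u v) w : ℝ) = inner ℝ (S u w) v)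
    (hcomm : ∀ u v w, S (S u v) w = S (S u w) v)
    (htr : ∀ w, LinearMap.trace ℝ V (S.flip w) = 0) (u v : V) : S u v = 0 := by
  let e : OrthonormalBasis (Fin 2) ℝ V := (stdOrthonormalBasis ℝ V).reindex (finCongr hV)
  have htr' : ∀ w, (inner ℝ (S (e 0) (e 0)) w : ℝ) + inner ℝ (S (e 1) (e 1)) w = 0 := by
    intro w
    have h := htr w
    rw [LinearMap.trace_eq_sum_inner _ e, Fin.sum_univ_two] at h
    rw [hS' _ _ w, hS' _ _ w, real_inner_comm, real_inner_comm (e 1)]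
    exact h
  have expand : ∀ x : V, x = (inner ℝ x (e 0) : ℝ) • e 0 + (inner ℝ x (e 1) : ℝ) • e 1 := by
    intro x
    have h := e.sum_repr' x
    rw [Fin.sum_univ_two] at h
    rw [real_inner_comm, real_inner_comm (e 1)]
    exact h.symm
  set a : ℝ := inner ℝ (S (e 0) (e 0)) (e 0) with ha
  set b : ℝ := inner ℝ (S (e 0) (e 0)) (e 1) with hb
  have h010 : (inner ℝ (S (e 0) (e 1)) (e 0) : ℝ) = b := by rw [hS']
  have h110 : (inner ℝ (S (e 1) (e 1)) (e 0) : ℝ) = -a := by linarith [htr' (e 0)]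
  have h111 : (inner ℝ (S (e 1) (e 1)) (e 1) : ℝ) = -b := by linarith [htr' (e 1)]
  have h011 : (inner ℝ (S (e 0) (e 1)) (e 1) : ℝ) = -a := by rw [hS, hS', h110]
  have h00 : S (e 0) (e 0) = a • e 0 + b • e 1 := expand _
  have h01 : S (e 0) (e 1) = b • e 0 + (-a) • e 1 := by
    have := expand (S (e 0) (e 1))
    rwa [h010, h011] at this
  have h11 : S (e 1) (e 1) = (-a) • e 0 + (-b) • e 1 := by
    have := expand (S (e 1) (e 1))
    rwa [h110, h111] at this
  have hab : a ^ 2 + b ^ 2 = 0 := by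
    have h := congrArg (fun x ↦ (inner ℝ x (e 1) : ℝ)) (hcomm (e 0) (e 0) (e 1))
    rw [h00, h01] at h
    simp only [map_add, map_smul, LinearMap.add_apply, LinearMap.smul_apply, inner_add_left,
      real_inner_smul_left] at h
    rw [h011, h111, hS (e 1) (e 0), h011, ← hb] at h
    nlinarith
  have ha0 : a = 0 := by nlinarith [sq_nonneg a, sq_nonneg b]
  have hb0 : b = 0 := by nlinarith [sq_nonneg a, sq_nonneg b]
  rw [ha0, hb0] at h00 h01 h11
  rw [expand u, expand v]
  simp [h00, h01, h11, hS (e 1) (e 0)]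

end Plane

section SecondFundamentalForm

variable {E : Type*} [NormedAddCommGroup E] [NormedSpace ℝ E] [FiniteDimensional ℝ E]
  {M : Type*} [TopologicalSpace M] [ChartedSpace E M] [IsManifold 𝓘(ℝ, E) ∞ M]
  [RiemannianBundle (fun x : M ↦ TangentSpace 𝓘(ℝ, E) x)]
  [IsContMDiffRiemannianBundle 𝓘(ℝ, E) ∞ E (fun x : M ↦ TangentSpace 𝓘(ℝ, E) x)]
  {E' : Type*} [NormedAddCommGroup E'] [NormedSpace ℝ E'] [FiniteDimensional ℝ E']
  {N : Type*} [TopologicalSpace N] [ChartedSpace E' N] [IsManifold 𝓘(ℝ, E') ∞ N]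
  [RiemannianBundle (fun y : N ↦ TangentSpace 𝓘(ℝ, E') y)]
  [IsContMDiffRiemannianBundle 𝓘(ℝ, E') ∞ E' (fun y : N ↦ TangentSpace 𝓘(ℝ, E') y)]
  {F : M → N} {p : M}

theorem diffAlongAt_mfderiv (hF : ContMDiffAt 𝓘(ℝ, E) 𝓘(ℝ, E') ∞ F p)
    {Y : Π x : M, TangentSpace 𝓘(ℝ, E) x} (hY : MDiffAt (T% Y) p) :
    DiffAlongAt E F (fun x ↦ mfderiv 𝓘(ℝ, E) 𝓘(ℝ, E') F x (Y x)) p :=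
  MDifferentiableAt.clm_apply_of_inCoordinates (b₁ := fun x : M ↦ x)
    ((hF.mfderiv_const (m := ∞) (by simp)).mdifferentiableAt (by simp)) hY
    (hF.mdifferentiableAt (by simp))

theorem smoothAlongAt_mfderiv (hF : ContMDiffAt 𝓘(ℝ, E) 𝓘(ℝ, E') ∞ F p)
    {Y : Π x : M, TangentSpace 𝓘(ℝ, E) x} (hY : CMDiffAt ∞ (T% Y) p) :
    SmoothAlongAt E F (fun x ↦ mfderiv 𝓘(ℝ, E) 𝓘(ℝ, E') F x (Y x)) p :=
  contMDiffAt_mfderiv_apply hF hY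

theorem tensorialAt_secondFundamentalForm (hF : ContMDiffAt 𝓘(ℝ, E) 𝓘(ℝ, E') ∞ F p)
    (X : Π x : M, TangentSpace 𝓘(ℝ, E) x) :
    TensorialAt 𝓘(ℝ, E) E (fun Y ↦ secondFundamentalForm E E' F X Y p) p where
  smul {f Y} hf hY := by
    have h1 : covAlong E E' F (fun x ↦ mfderiv 𝓘(ℝ, E) 𝓘(ℝ, E') F x ((f • Y) x)) p (X p) =
        f p • covAlong E E' F (fun x ↦ mfderiv 𝓘(ℝ, E) 𝓘(ℝ, E') F x (Y x)) p (X p)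
          + mvfderiv 𝓘(ℝ, E) f p (X p) • mfderiv 𝓘(ℝ, E) 𝓘(ℝ, E') F p (Y p) := by
      simp only [Pi.smul_apply', map_smul]
      exact covAlong_smul hf (diffAlongAt_mfderiv hF hY) (X p)
    rw [secondFundamentalForm, secondFundamentalForm, h1,
      leviCivita.isCovariantDerivativeOn.leibniz hY hf, add_apply, smul_apply,
      ContinuousLinearMap.smulRight_apply, map_add, map_smul, map_smul, smul_sub]
    abel
  add {Y Y'} hY hY' := by
    have h1 : covAlong E E' F (fun x ↦ mfderiv 𝓘(ℝ, E) 𝓘(ℝ, E') F x ((Y + Y') x)) p (X p) =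
        covAlong E E' F (fun x ↦ mfderiv 𝓘(ℝ, E) 𝓘(ℝ, E') F x (Y x)) p (X p)
          + covAlong E E' F (fun x ↦ mfderiv 𝓘(ℝ, E) 𝓘(ℝ, E') F x (Y' x)) p (X p) := by
      simp only [Pi.add_apply, map_add]
      exact covAlong_add (diffAlongAt_mfderiv hF hY) (diffAlongAt_mfderiv hF hY') (X p)
    rw [secondFundamentalForm, secondFundamentalForm, secondFundamentalForm, h1,
      leviCivita.isCovariantDerivativeOn.add hY hY', add_apply, map_add]
    abel

theorem secondFundamentalForm_eq_at (hF : ContMDiffAt 𝓘(ℝ, E) 𝓘(ℝ, E') ∞ F p)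
    (X : Π x : M, TangentSpace 𝓘(ℝ, E) x) {Y : Π x : M, TangentSpace 𝓘(ℝ, E) x}
    (hY : MDiffAt (T% Y) p) :
    secondFundamentalForm E E' F X Y p = secondFundamentalFormAt E E' F p (X p) (Y p) := by
  have h1 := (tensorialAt_secondFundamentalForm hF X).pointwise hY
    (mdifferentiableAt_extend 𝓘(ℝ, E) E (Y p)) (extend_apply_self (F := E) (Y p)).symm
  rw [h1, secondFundamentalFormAt, secondFundamentalForm, secondFundamentalForm, extend_apply_self]

theorem covAlong_mfderiv (hF : ContMDiffAt 𝓘(ℝ, E) 𝓘(ℝ, E') ∞ F p)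
    {Y : Π x : M, TangentSpace 𝓘(ℝ, E) x} (hY : MDiffAt (T% Y) p) (u : TangentSpace 𝓘(ℝ, E) p) :
    covAlong E E' F (fun x ↦ mfderiv 𝓘(ℝ, E) 𝓘(ℝ, E') F x (Y x)) p u =
      mfderiv 𝓘(ℝ, E) 𝓘(ℝ, E') F p (leviCivita Y p u)
        + secondFundamentalFormAt E E' F p u (Y p) := by
  have h1 := secondFundamentalForm_eq_at hF (extend E u) hY
  rw [secondFundamentalForm, extend_apply_self] at h1
  rw [← h1]
  abel

theorem secondFundamentalFormAt_add_left (u u' v : TangentSpace 𝓘(ℝ, E) p) :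
    secondFundamentalFormAt E E' F p (u + u') v =
      secondFundamentalFormAt E E' F p u v + secondFundamentalFormAt E E' F p u' v := by
  simp only [secondFundamentalFormAt, secondFundamentalForm, extend_apply_self, map_add]
  abel

theorem secondFundamentalFormAt_smul_left (a : ℝ) (u v : TangentSpace 𝓘(ℝ, E) p) :
    secondFundamentalFormAt E E' F p (a • u) v = a • secondFundamentalFormAt E E' F p u v := by
  simp only [secondFundamentalFormAt, secondFundamentalForm, extend_apply_self, map_smul, smul_sub]

theorem secondFundamentalFormAt_comm (hF : ContMDiffAt 𝓘(ℝ, E) 𝓘(ℝ, E') ∞ F p)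
    (u v : TangentSpace 𝓘(ℝ, E) p) :
    secondFundamentalFormAt E E' F p u v = secondFundamentalFormAt E E' F p v u := by
  have hu := contMDiffAt_extend (k := ∞) 𝓘(ℝ, E) E u
  have hv := contMDiffAt_extend (k := ∞) 𝓘(ℝ, E) E v
  have h1 := covAlong_mfderiv_sub hF hu hv
  rw [← leviCivita_torsion (hu.mdifferentiableAt (by simp)) (hv.mdifferentiableAt (by simp)),
    map_sub] at h1
  rw [← sub_eq_zero, secondFundamentalFormAt, secondFundamentalFormAt, secondFundamentalForm,
    secondFundamentalForm, sub_sub_sub_comm, h1, sub_self]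

theorem secondFundamentalFormAt_add_right (hF : ContMDiffAt 𝓘(ℝ, E) 𝓘(ℝ, E') ∞ F p)
    (u v v' : TangentSpace 𝓘(ℝ, E) p) :
    secondFundamentalFormAt E E' F p u (v + v') =
      secondFundamentalFormAt E E' F p u v + secondFundamentalFormAt E E' F p u v' := by
  rw [secondFundamentalFormAt_comm hF, secondFundamentalFormAt_add_left,
    secondFundamentalFormAt_comm hF v, secondFundamentalFormAt_comm hF v']

theorem secondFundamentalFormAt_smul_right (hF : ContMDiffAt 𝓘(ℝ, E) 𝓘(ℝ, E') ∞ F p)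
    (a : ℝ) (u v : TangentSpace 𝓘(ℝ, E) p) :
    secondFundamentalFormAt E E' F p u (a • v) = a • secondFundamentalFormAt E E' F p u v := by
  rw [secondFundamentalFormAt_comm hF, secondFundamentalFormAt_smul_left,
    secondFundamentalFormAt_comm hF v]

theorem inner_secondFundamentalFormAt_swap (hF : IsIsometricImmersion E E' F)
    (u v w : TangentSpace 𝓘(ℝ, E) p) :
    (inner ℝ (secondFundamentalFormAt E E' F p u v) (mfderiv 𝓘(ℝ, E) 𝓘(ℝ, E') F p w) : ℝ) =
      -inner ℝ (secondFundamentalFormAt E E' F p u w) (mfderiv 𝓘(ℝ, E) 𝓘(ℝ, E') F p v) := by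
  have hFp := hF.contMDiff.contMDiffAt (x := p)
  have hv := contMDiffAt_extend (k := ∞) 𝓘(ℝ, E) E v
  have hw := contMDiffAt_extend (k := ∞) 𝓘(ℝ, E) E w
  have hv' := mdifferentiableAt_extend 𝓘(ℝ, E) E v
  have hw' := mdifferentiableAt_extend 𝓘(ℝ, E) E w
  have h1 := covAlong_metric (smoothAlongAt_mfderiv hFp hv) (smoothAlongAt_mfderiv hFp hw) u
  simp only [hF.inner_map] at h1
  have h2 := leviCivita_metric (mdifferentiableAt_extend 𝓘(ℝ, E) E u) hv' hw'
  rw [extend_apply_self] at h2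
  rw [h2, covAlong_mfderiv hFp hv', covAlong_mfderiv hFp hw'] at h1
  simp only [extend_apply_self, inner_add_left, inner_add_right, hF.inner_map] at h1
  rw [real_inner_comm (secondFundamentalFormAt E E' F p u w)] at h1
  linarith

/-- The second fundamental form takes values in the normal space. -/
theorem inner_secondFundamentalFormAt_mfderiv (hF : IsIsometricImmersion E E' F)
    (u v w : TangentSpace 𝓘(ℝ, E) p) :
    (inner ℝ (secondFundamentalFormAt E E' F p u v) (mfderiv 𝓘(ℝ, E) 𝓘(ℝ, E') F p w) : ℝ) = 0 := by
  have hFp := hF.contMDiff.contMDiffAt (x := p)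
  have h1 := inner_secondFundamentalFormAt_swap hF u v w
  have h2 := inner_secondFundamentalFormAt_swap hF v w u
  have h3 := inner_secondFundamentalFormAt_swap hF w u v
  rw [secondFundamentalFormAt_comm hFp v u] at h2
  rw [secondFundamentalFormAt_comm hFp w u, secondFundamentalFormAt_comm hFp w v] at h3
  linarith

theorem smoothAlongAt_secondFundamentalFormAt (hF : ContMDiff 𝓘(ℝ, E) 𝓘(ℝ, E') ∞ F)
    {X Y : Π x : M, TangentSpace 𝓘(ℝ, E) x} (hX : CMDiffAt ∞ (T% X) p)
    (hY : CMDiffAt ∞ (T% Y) p) :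
    SmoothAlongAt E F (fun x ↦ secondFundamentalFormAt E E' F x (X x) (Y x)) p := by
  refine ((smoothAlongAt_covAlong (smoothAlongAt_mfderiv (hF p) hY) hX).sub
    (smoothAlongAt_mfderiv (hF p) (contMDiffAt_leviCivita hX hY))).congr ?_
  filter_upwards [eventually_mdifferentiableAt hY] with x hx
  exact secondFundamentalForm_eq_at (hF x) X hx

end SecondFundamentalForm

section Trace

variable {E : Type*} [NormedAddCommGroup E] [NormedSpace ℝ E] [FiniteDimensional ℝ E]
  {M : Type*} [TopologicalSpace M] [ChartedSpace E M] [IsManifold 𝓘(ℝ, E) ∞ M]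

/-- The trace of a smooth field of endomorphisms of the tangent bundle is smooth. -/
theorem contMDiffAt_trace {p : M}
    {T : Π x : M, TangentSpace 𝓘(ℝ, E) x →ₗ[ℝ] TangentSpace 𝓘(ℝ, E) x}
    (hT : ∀ W : Π x : M, TangentSpace 𝓘(ℝ, E) x, CMDiffAt ∞ (T% W) p →
      CMDiffAt ∞ (T% (fun x ↦ T x (W x))) p) :
    ContMDiffAt 𝓘(ℝ, E) 𝓘(ℝ, ℝ) ∞ (fun x ↦ LinearMap.trace ℝ (TangentSpace 𝓘(ℝ, E) x) (T x)) p := by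
  set e := trivializationAt E (TangentSpace 𝓘(ℝ, E)) p
  have hp : p ∈ e.baseSet := FiberBundle.mem_baseSet_trivializationAt' p
  let b := Module.finBasis ℝ E
  let w := e.localFrame b
  have h : ContMDiffAt 𝓘(ℝ, E) 𝓘(ℝ, ℝ) ∞
      (fun x ↦ ∑ i, e.localFrameCoeff 𝓘(ℝ, E) b i x (T x (w i x))) p :=
    ContMDiffAt.sum fun i _ ↦ contMDiffAt_localFrameCoeff b hp
      (hT _ (contMDiffAt_localFrame_of_mem (I := 𝓘(ℝ, E)) ∞ e b i hp)) i
  refine h.congr_of_eventuallyEq ?_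
  filter_upwards [e.open_baseSet.mem_nhds hp] with x hx
  rw [LinearMap.trace_eq_matrix_trace ℝ (e.basisAt b hx), Matrix.trace]
  refine Finset.sum_congr rfl fun i _ ↦ ?_
  rw [Matrix.diag_apply, LinearMap.toMatrix_apply]
  have h1 : w i x = e.basisAt b hx i := e.localFrame_apply_of_mem_baseSet b hx
  rw [← h1]
  exact (e.localFrameCoeff_apply_of_mem_baseSet (I := 𝓘(ℝ, E)) b hx (fun x ↦ T x (w i x)) i).symm

end Trace

theorem IsKahler.inner_left {E' : Type*} [NormedAddCommGroup E'] [NormedSpace ℝ E']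
    [FiniteDimensional ℝ E'] {N : Type*} [TopologicalSpace N] [ChartedSpace E' N]
    [IsManifold 𝓘(ℝ, E') ∞ N] [RiemannianBundle (fun y : N ↦ TangentSpace 𝓘(ℝ, E') y)]
    [IsContMDiffRiemannianBundle 𝓘(ℝ, E') ∞ E' (fun y : N ↦ TangentSpace 𝓘(ℝ, E') y)]
    {J : Π y : N, TangentSpace 𝓘(ℝ, E') y →L[ℝ] TangentSpace 𝓘(ℝ, E') y} (hJ : IsKahler J)
    {y : N} (v w : TangentSpace 𝓘(ℝ, E') y) :
    (inner ℝ (J y v) w : ℝ) = -inner ℝ v (J y w) := by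
  rw [← hJ.inner_map, hJ.sq, inner_neg_left]

section TotallyReal

variable {E : Type*} [NormedAddCommGroup E] [NormedSpace ℝ E] [FiniteDimensional ℝ E]
  {M : Type*} [TopologicalSpace M] [ChartedSpace E M] [IsManifold 𝓘(ℝ, E) ∞ M]
  [RiemannianBundle (fun x : M ↦ TangentSpace 𝓘(ℝ, E) x)]
  [IsContMDiffRiemannianBundle 𝓘(ℝ, E) ∞ E (fun x : M ↦ TangentSpace 𝓘(ℝ, E) x)]
  {E' : Type*} [NormedAddCommGroup E'] [NormedSpace ℝ E'] [FiniteDimensional ℝ E']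
  {N : Type*} [TopologicalSpace N] [ChartedSpace E' N] [IsManifold 𝓘(ℝ, E') ∞ N]
  [RiemannianBundle (fun y : N ↦ TangentSpace 𝓘(ℝ, E') y)]
  [IsContMDiffRiemannianBundle 𝓘(ℝ, E') ∞ E' (fun y : N ↦ TangentSpace 𝓘(ℝ, E') y)]
  {F : M → N} {p : M}
  {J : Π y : N, TangentSpace 𝓘(ℝ, E') y →L[ℝ] TangentSpace 𝓘(ℝ, E') y}

theorem covAlong_zero (hF : MDifferentiableAt 𝓘(ℝ, E) 𝓘(ℝ, E') F p) :
    covAlong E E' F (fun _ ↦ 0) p = 0 := by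
  ext u
  have h0 : MDiffAt (T% (fun y : N ↦ (0 : TangentSpace 𝓘(ℝ, E') y))) (F p) :=
    mdifferentiableAt_zeroSection ..
  have h1 : DiffAlongAt E F (fun _ ↦ 0) p := h0.comp p hF
  have h2 := covAlong_add h1 h1 u
  simpa using h2

theorem normalPart_add_tangentPart (v : TangentSpace 𝓘(ℝ, E') (F p)) :
    normalPart E E' F p v + mfderiv 𝓘(ℝ, E) 𝓘(ℝ, E') F p (tangentPart E E' F p v) = v := by
  simp [normalPart]

theorem normalPart_mfderiv (hF : IsIsometricImmersion E E' F) (u : TangentSpace 𝓘(ℝ, E) p) :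
    normalPart E E' F p (mfderiv 𝓘(ℝ, E) 𝓘(ℝ, E') F p u) = 0 := by
  simp [normalPart, tangentPart_mfderiv E E' hF]

theorem normalPart_eq_self {v : TangentSpace 𝓘(ℝ, E') (F p)}
    (hv : ∀ u : TangentSpace 𝓘(ℝ, E) p, (inner ℝ (mfderiv 𝓘(ℝ, E) 𝓘(ℝ, E') F p u) v : ℝ) = 0) :
    normalPart E E' F p v = v := by
  simp [normalPart, tangentPart_eq_zero E E' F p v hv]

theorem IsTotallyReal.inner_right (hreal : IsTotallyReal E E' F J)
    (u v : TangentSpace 𝓘(ℝ, E) p) :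
    (inner ℝ (mfderiv 𝓘(ℝ, E) 𝓘(ℝ, E') F p u) (J (F p) (mfderiv 𝓘(ℝ, E) 𝓘(ℝ, E') F p v)) : ℝ)
      = 0 := by
  rw [real_inner_comm, hreal]

theorem IsTotallyReal.isNormalField (hreal : IsTotallyReal E E' F J) (hJ : IsKahler J)
    (hF : IsIsometricImmersion E E' F) {Y : Π x : M, TangentSpace 𝓘(ℝ, E) x}
    (hY : ContMDiff 𝓘(ℝ, E) (𝓘(ℝ, E).prod 𝓘(ℝ, E)) ∞ (T% Y)) :
    IsNormalField E E' F (fun x ↦ J (F x) (mfderiv 𝓘(ℝ, E) 𝓘(ℝ, E') F x (Y x))) where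
  contMDiff p := hJ.smoothAlongAt (smoothAlongAt_mfderiv (hF.contMDiff p) (hY p))
  normal p u := hreal.inner_right u (Y p)

theorem fStructure_complex_mfderiv (hJ : IsKahler J) (hF : IsIsometricImmersion E E' F)
    (u : TangentSpace 𝓘(ℝ, E) p) :
    fStructure E E' F J p (J (F p) (mfderiv 𝓘(ℝ, E) 𝓘(ℝ, E') F p u)) = 0 := by
  rw [fStructure, ContinuousLinearMap.comp_apply, hJ.sq, map_neg, normalPart_mfderiv hF, neg_zero]

theorem covAlong_complex_mfderiv (hJ : IsKahler J) (hF : IsIsometricImmersion E E' F)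
    {Y : Π x : M, TangentSpace 𝓘(ℝ, E) x} (hY : CMDiffAt ∞ (T% Y) p)
    (u : TangentSpace 𝓘(ℝ, E) p) :
    covAlong E E' F (fun x ↦ J (F x) (mfderiv 𝓘(ℝ, E) 𝓘(ℝ, E') F x (Y x))) p u =
      J (F p) (mfderiv 𝓘(ℝ, E) 𝓘(ℝ, E') F p (leviCivita Y p u))
        + J (F p) (secondFundamentalFormAt E E' F p u (Y p)) := by
  rw [hJ.covAlong (smoothAlongAt_mfderiv (hF.contMDiff p) hY),
    covAlong_mfderiv (hF.contMDiff p) (hY.mdifferentiableAt (by simp)), map_add]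

/-- The normal derivative of the normal vector field `J Y`. -/
theorem normalDeriv_complex_mfderiv (hJ : IsKahler J) (hF : IsIsometricImmersion E E' F)
    (hreal : IsTotallyReal E E' F J)
    {Y : Π x : M, TangentSpace 𝓘(ℝ, E) x} (hY : CMDiffAt ∞ (T% Y) p)
    (u : TangentSpace 𝓘(ℝ, E) p) :
    normalDeriv E E' F (fun x ↦ J (F x) (mfderiv 𝓘(ℝ, E) 𝓘(ℝ, E') F x (Y x))) p u =
      J (F p) (mfderiv 𝓘(ℝ, E) 𝓘(ℝ, E') F p (leviCivita Y p u))
        + fStructure E E' F J p (secondFundamentalFormAt E E' F p u (Y p)) := by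
  rw [normalDeriv, ContinuousLinearMap.comp_apply, covAlong_complex_mfderiv hJ hF hY, map_add,
    normalPart_eq_self fun w ↦ hreal.inner_right w _]
  rfl

/-- If the `f`-structure of a totally real submanifold is parallel, then it vanishes on the first
normal space. -/
theorem fStructure_secondFundamentalFormAt [T2Space M] (hJ : IsKahler J)
    (hF : IsIsometricImmersion E E' F) (hreal : IsTotallyReal E E' F J)
    (hf : HasParallelFStructure E E' F J) (u v : TangentSpace 𝓘(ℝ, E) p) :
    fStructure E E' F J p (secondFundamentalFormAt E E' F p u v) = 0 := by
  obtain ⟨Y, hY, rfl⟩ := exists_contMDiff_apply_eq v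
  have h := hf _ (hreal.isNormalField hJ hF hY) p u
  simp only [fStructure_complex_mfderiv hJ hF] at h
  rw [normalDeriv, covAlong_zero ((hF.contMDiff p).mdifferentiableAt (by simp)),
    ContinuousLinearMap.comp_zero, normalDeriv_complex_mfderiv hJ hF hreal (hY p), map_add,
    fStructure_complex_mfderiv hJ hF, zero_add] at h
  set s := secondFundamentalFormAt E E' F p u (Y p)
  set n := fStructure E E' F J p s with hn
  have h0 : normalPart E E' F p (J (F p) n) = 0 := h.symm
  have h1 := normalPart_add_tangentPart (E := E) (J (F p) n)
  rw [h0, zero_add] at h1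
  have h2 := normalPart_add_tangentPart (E := E) (J (F p) s)
  have h3 : ∀ w, (inner ℝ (mfderiv 𝓘(ℝ, E) 𝓘(ℝ, E') F p w) n : ℝ) = 0 := fun w ↦
    inner_normalPart E E' hF p w _
  refine (inner_self_eq_zero (𝕜 := ℝ)).1 ?_
  calc (inner ℝ n n : ℝ)
      = inner ℝ (n + mfderiv 𝓘(ℝ, E) 𝓘(ℝ, E') F p (tangentPart E E' F p (J (F p) s))) n := by
        rw [inner_add_left, h3, add_zero]
    _ = inner ℝ (J (F p) s) n := congrArg (fun v ↦ (inner ℝ v n : ℝ)) h2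
    _ = 0 := by
        rw [hJ.inner_left, ← h1, inner_secondFundamentalFormAt_mfderiv hF, neg_zero]

variable (J) in
/-- The bilinear map `(u, v) ↦ -J σ(u, v)` on tangent vectors (its tangential part). -/
def complexForm (hF : ContMDiff 𝓘(ℝ, E) 𝓘(ℝ, E') ∞ F) (p : M) :
    TangentSpace 𝓘(ℝ, E) p →ₗ[ℝ] TangentSpace 𝓘(ℝ, E) p →ₗ[ℝ] TangentSpace 𝓘(ℝ, E) p :=
  LinearMap.mk₂ ℝ
    (fun u v ↦ -tangentPart E E' F p (J (F p) (secondFundamentalFormAt E E' F p u v)))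
    (fun u u' v ↦ by rw [secondFundamentalFormAt_add_left, map_add, map_add, neg_add])
    (fun a u v ↦ by rw [secondFundamentalFormAt_smul_left, map_smul, map_smul, smul_neg])
    (fun u v v' ↦ by rw [secondFundamentalFormAt_add_right (hF p), map_add, map_add, neg_add])
    (fun a u v ↦ by rw [secondFundamentalFormAt_smul_right (hF p), map_smul, map_smul, smul_neg])

theorem complexForm_apply (hF : ContMDiff 𝓘(ℝ, E) 𝓘(ℝ, E') ∞ F) (u v : TangentSpace 𝓘(ℝ, E) p) :
    complexForm J hF p u v =
      -tangentPart E E' F p (J (F p) (secondFundamentalFormAt E E' F p u v)) := rfl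

theorem complexForm_comm (hF : ContMDiff 𝓘(ℝ, E) 𝓘(ℝ, E') ∞ F) (u v : TangentSpace 𝓘(ℝ, E) p) :
    complexForm J hF p u v = complexForm J hF p v u := by
  rw [complexForm_apply, complexForm_apply, secondFundamentalFormAt_comm (hF p)]

theorem inner_complexForm (hJ : IsKahler J) (hF : ContMDiff 𝓘(ℝ, E) 𝓘(ℝ, E') ∞ F)
    (u v w : TangentSpace 𝓘(ℝ, E) p) :
    (inner ℝ (complexForm J hF p u v) w : ℝ) =
      inner ℝ (secondFundamentalFormAt E E' F p u v)
        (J (F p) (mfderiv 𝓘(ℝ, E) 𝓘(ℝ, E') F p w)) := by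
  rw [complexForm_apply, inner_neg_left, tangentPart, ContinuousLinearMap.adjoint_inner_left,
    hJ.inner_left, neg_neg]

theorem inner_complexForm_swap (hJ : IsKahler J) (hF : IsIsometricImmersion E E' F)
    (hreal : IsTotallyReal E E' F J) (u v w : TangentSpace 𝓘(ℝ, E) p) :
    (inner ℝ (complexForm J hF.contMDiff p u v) w : ℝ) =
      inner ℝ (complexForm J hF.contMDiff p u w) v := by
  have hv := contMDiffAt_extend (k := ∞) 𝓘(ℝ, E) E v
  have hw := contMDiffAt_extend (k := ∞) 𝓘(ℝ, E) E w
  have hv' := smoothAlongAt_mfderiv (hF.contMDiff p) hv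
  have hw' := smoothAlongAt_mfderiv (hF.contMDiff p) hw
  have h1 := covAlong_metric hv' (hJ.smoothAlongAt hw') u
  simp only [hreal.inner_right] at h1
  rw [mvfderiv_const, covAlong_complex_mfderiv hJ hF hw,
    covAlong_mfderiv (hF.contMDiff p) (hv.mdifferentiableAt (by simp))] at h1
  simp only [extend_apply_self, inner_add_left, inner_add_right, hreal.inner_right, zero_add] at h1
  rw [real_inner_comm (J (F p) (secondFundamentalFormAt E E' F p u w)), hJ.inner_left] at h1
  have h2 : (0 : TangentSpace 𝓘(ℝ, E) p →L[ℝ] ℝ) u = 0 := rfl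
  rw [h2] at h1
  rw [inner_complexForm hJ, inner_complexForm hJ]
  linarith

theorem shapeOperator_complex_mfderiv (hJ : IsKahler J) (hF : IsIsometricImmersion E E' F)
    (hreal : IsTotallyReal E E' F J)
    {Y : Π x : M, TangentSpace 𝓘(ℝ, E) x} (hY : CMDiffAt ∞ (T% Y) p)
    (u : TangentSpace 𝓘(ℝ, E) p) :
    shapeOperator E E' F (fun x ↦ J (F x) (mfderiv 𝓘(ℝ, E) 𝓘(ℝ, E') F x (Y x))) p u =
      complexForm J hF.contMDiff p u (Y p) := by
  rw [shapeOperator, neg_apply, ContinuousLinearMap.comp_apply, covAlong_complex_mfderiv hJ hF hY,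
    map_add, tangentPart_eq_zero E E' F p _ fun w ↦ hreal.inner_right w _, zero_add,
    complexForm_apply]

theorem complexForm_complexForm_comm [T2Space M] (hJ : IsKahler J)
    (hF : IsIsometricImmersion E E' F) (hreal : IsTotallyReal E E' F J)
    (hcomm : HasCommutativeSecondFundamentalForms E E' F) (u v w : TangentSpace 𝓘(ℝ, E) p) :
    complexForm J hF.contMDiff p (complexForm J hF.contMDiff p u v) w =
      complexForm J hF.contMDiff p (complexForm J hF.contMDiff p u w) v := by
  obtain ⟨Y, hY, rfl⟩ := exists_contMDiff_apply_eq v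
  obtain ⟨Z, hZ, rfl⟩ := exists_contMDiff_apply_eq w
  have h := congrArg (fun L ↦ L u) (hcomm _ _ (hreal.isNormalField hJ hF hZ)
    (hreal.isNormalField hJ hF hY) p)
  simpa only [ContinuousLinearMap.comp_apply, shapeOperator_complex_mfderiv hJ hF hreal (hY p),
    shapeOperator_complex_mfderiv hJ hF hreal (hZ p)] using h

theorem secondFundamentalFormAt_eq_complexForm [T2Space M] (hJ : IsKahler J)
    (hF : IsIsometricImmersion E E' F) (hreal : IsTotallyReal E E' F J)
    (hf : HasParallelFStructure E E' F J) (u v : TangentSpace 𝓘(ℝ, E) p) :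
    secondFundamentalFormAt E E' F p u v =
      J (F p) (mfderiv 𝓘(ℝ, E) 𝓘(ℝ, E') F p (complexForm J hF.contMDiff p u v)) := by
  have h0 : normalPart E E' F p (J (F p) (secondFundamentalFormAt E E' F p u v)) = 0 :=
    fStructure_secondFundamentalFormAt hJ hF hreal hf u v
  have h := normalPart_add_tangentPart (E := E) (J (F p) (secondFundamentalFormAt E E' F p u v))
  rw [h0, zero_add] at h
  rw [complexForm_apply, map_neg, map_neg, h, hJ.sq, neg_neg]

variable (J) in
/-- The tangent vector field `-J H`. -/
def complexMeanCurvature (hF : ContMDiff 𝓘(ℝ, E) 𝓘(ℝ, E') ∞ F) (p : M) : TangentSpace 𝓘(ℝ, E) p :=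
  (Module.finrank ℝ E : ℝ)⁻¹ • ∑ i,
    complexForm J hF p (stdOrthonormalBasis ℝ (TangentSpace 𝓘(ℝ, E) p) i)
      (stdOrthonormalBasis ℝ (TangentSpace 𝓘(ℝ, E) p) i)

theorem meanCurvature_eq_complexMeanCurvature [T2Space M] (hJ : IsKahler J)
    (hF : IsIsometricImmersion E E' F) (hreal : IsTotallyReal E E' F J)
    (hf : HasParallelFStructure E E' F J) (p : M) :
    meanCurvature E E' F p =
      J (F p) (mfderiv 𝓘(ℝ, E) 𝓘(ℝ, E') F p (complexMeanCurvature J hF.contMDiff p)) := by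
  simp only [meanCurvature, complexMeanCurvature, map_smul, map_sum,
    secondFundamentalFormAt_eq_complexForm hJ hF hreal hf]

theorem inner_complexMeanCurvature (hJ : IsKahler J) (hF : IsIsometricImmersion E E' F)
    (hreal : IsTotallyReal E E' F J) (w : TangentSpace 𝓘(ℝ, E) p) :
    (inner ℝ (complexMeanCurvature J hF.contMDiff p) w : ℝ) = (Module.finrank ℝ E : ℝ)⁻¹ *
      LinearMap.trace ℝ (TangentSpace 𝓘(ℝ, E) p) ((complexForm J hF.contMDiff p).flip w) := by
  rw [complexMeanCurvature, real_inner_smul_left, sum_inner,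
    LinearMap.trace_eq_sum_inner _ (stdOrthonormalBasis ℝ (TangentSpace 𝓘(ℝ, E) p))]
  congr 1
  refine Finset.sum_congr rfl fun i _ ↦ ?_
  rw [inner_complexForm_swap hJ hF hreal, real_inner_comm, LinearMap.flip_apply]

theorem contMDiffAt_complexForm (hJ : IsKahler J) (hF : ContMDiff 𝓘(ℝ, E) 𝓘(ℝ, E') ∞ F)
    {X Y : Π x : M, TangentSpace 𝓘(ℝ, E) x} (hX : CMDiffAt ∞ (T% X) p)
    (hY : CMDiffAt ∞ (T% Y) p) :
    CMDiffAt ∞ (T% (fun x ↦ complexForm J hF x (X x) (Y x))) p := by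
  refine contMDiffAt_of_inner fun Z hZ ↦ ?_
  simp only [inner_complexForm hJ]
  exact smoothAlongAt_inner (smoothAlongAt_secondFundamentalFormAt hF hX hY)
    (hJ.smoothAlongAt (smoothAlongAt_mfderiv (hF p) hZ))

theorem contMDiffAt_complexMeanCurvature (hJ : IsKahler J) (hF : IsIsometricImmersion E E' F)
    (hreal : IsTotallyReal E E' F J) :
    CMDiffAt ∞ (T% (complexMeanCurvature J hF.contMDiff)) p := by
  refine contMDiffAt_of_inner fun Z hZ ↦ ?_
  have h : ContMDiffAt 𝓘(ℝ, E) 𝓘(ℝ, ℝ) ∞ (fun x ↦ LinearMap.trace ℝ (TangentSpace 𝓘(ℝ, E) x)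
      ((complexForm J hF.contMDiff x).flip (Z x))) p :=
    contMDiffAt_trace fun W hW ↦ by
      simpa only [LinearMap.flip_apply] using contMDiffAt_complexForm hJ hF.contMDiff hW hZ
  have h' : ContMDiffAt 𝓘(ℝ, E) 𝓘(ℝ, ℝ) ∞ (fun x ↦ (Module.finrank ℝ E : ℝ)⁻¹ *
      LinearMap.trace ℝ (TangentSpace 𝓘(ℝ, E) x)
      ((complexForm J hF.contMDiff x).flip (Z x))) p := contMDiffAt_const.mul h
  refine h'.congr_of_eventuallyEq (.of_forall fun x ↦ ?_)
  exact inner_complexMeanCurvature hJ hF hreal (Z x)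

theorem leviCivita_complexMeanCurvature [T2Space M] (hJ : IsKahler J)
    (hF : IsIsometricImmersion E E' F) (hreal : IsTotallyReal E E' F J)
    (hf : HasParallelFStructure E E' F J) (hH : HasParallelMeanCurvature E E' F) (p : M) :
    leviCivita (complexMeanCurvature J hF.contMDiff) p = 0 := by
  ext u
  have h := hH p u
  have hfun : meanCurvature E E' F = fun x ↦
      J (F x) (mfderiv 𝓘(ℝ, E) 𝓘(ℝ, E') F x (complexMeanCurvature J hF.contMDiff x)) :=
    funext (meanCurvature_eq_complexMeanCurvature hJ hF hreal hf)
  rw [hfun, normalDeriv_complex_mfderiv hJ hF hreal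
    (contMDiffAt_complexMeanCurvature hJ hF hreal),
    fStructure_secondFundamentalFormAt hJ hF hreal hf, add_zero] at h
  refine (inner_self_eq_zero (𝕜 := ℝ)).1 ?_
  rw [← hF.inner_map, ← hJ.inner_map, h, inner_zero_left]

theorem inner_self_eq_of_parallel [PreconnectedSpace M] {h : Π x : M, TangentSpace 𝓘(ℝ, E) x}
    (hs : ∀ p, CMDiffAt ∞ (T% h) p) (hpar : ∀ p, leviCivita h p = 0) (x y : M) :
    (inner ℝ (h x) (h x) : ℝ) = inner ℝ (h y) (h y) := by
  refine eq_of_mvfderiv_eq_zero (f := fun x ↦ (inner ℝ (h x) (h x) : ℝ))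
    (fun p ↦ (contMDiffAt_inner (hs p) (hs p)).mdifferentiableAt (by simp)) (fun p ↦ ?_) x y
  ext u
  have hp := (hs p).mdifferentiableAt (by simp)
  have h1 := leviCivita_metric (mdifferentiableAt_extend 𝓘(ℝ, E) E u) hp hp
  rw [extend_apply_self, hpar] at h1
  rw [h1]
  simp

end TotallyReal

end

end TotReal

theorem proposition4
    -- the ambient Kähler manifold `N`, with complex structure `J`
    {E' : Type*} [NormedAddCommGroup E'] [NormedSpace ℝ E'] [FiniteDimensional ℝ E']
    {N : Type*} [TopologicalSpace N] [T2Space N] [ChartedSpace E' N] [IsManifold 𝓘(ℝ, E') ∞ N]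
    [RiemannianBundle (fun y : N ↦ TangentSpace 𝓘(ℝ, E') y)]
    [IsContMDiffRiemannianBundle 𝓘(ℝ, E') ∞ E' (fun y : N ↦ TangentSpace 𝓘(ℝ, E') y)]
    (J : Π y : N, TangentSpace 𝓘(ℝ, E') y →L[ℝ] TangentSpace 𝓘(ℝ, E') y)
    (hJ : TotReal.IsKahler J)
    -- the connected surface `M`, with the metric induced by the immersion `F`
    {E : Type*} [NormedAddCommGroup E] [NormedSpace ℝ E] [FiniteDimensional ℝ E]
    (hdim : Module.finrank ℝ E = 2)
    {M : Type*} [TopologicalSpace M] [T2Space M] [ConnectedSpace M] [ChartedSpace E M]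
    [IsManifold 𝓘(ℝ, E) ∞ M]
    [RiemannianBundle (fun x : M ↦ TangentSpace 𝓘(ℝ, E) x)]
    [IsContMDiffRiemannianBundle 𝓘(ℝ, E) ∞ E (fun x : M ↦ TangentSpace 𝓘(ℝ, E) x)]
    (F : M → N) (hF : TotReal.IsIsometricImmersion E E' F)
    (hreal : TotReal.IsTotallyReal E E' F J)
    (hcomm : TotReal.HasCommutativeSecondFundamentalForms E E' F)
    (hf : TotReal.HasParallelFStructure E E' F J)
    (hH : TotReal.HasParallelMeanCurvature E E' F) :
    TotReal.IsFlat E M ∨ TotReal.IsTotallyGeodesic E E' F := by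
  have hs : ∀ p, CMDiffAt ∞ (T% (TotReal.complexMeanCurvature J hF.contMDiff)) p := fun p ↦
    TotReal.contMDiffAt_complexMeanCurvature hJ hF hreal
  have hpar := TotReal.leviCivita_complexMeanCurvature hJ hF hreal hf hH
  by_cases hne : ∀ p, TotReal.complexMeanCurvature J hF.contMDiff p ≠ 0
  · exact Or.inl (TotReal.isFlat_of_parallel hdim hs hpar hne)
  · push Not at hne
    obtain ⟨q, hq⟩ := hne
    refine Or.inr fun p u v ↦ ?_
    have hzero : TotReal.complexMeanCurvature J hF.contMDiff p = 0 := by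
      refine (inner_self_eq_zero (𝕜 := ℝ)).1 ?_
      rw [TotReal.inner_self_eq_of_parallel hs hpar p q, hq, inner_zero_left]
    have hS : TotReal.complexForm J hF.contMDiff p u v = 0 := by
      refine TotReal.eq_zero_of_symmetric_of_commute hdim (TotReal.complexForm J hF.contMDiff p)
        (TotReal.complexForm_comm hF.contMDiff) (TotReal.inner_complexForm_swap hJ hF hreal)
        (TotReal.complexForm_complexForm_comm hJ hF hreal hcomm) (fun w ↦ ?_) u v
      have h := TotReal.inner_complexMeanCurvature hJ hF hreal w
      rw [hzero, inner_zero_left, hdim] at h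
      simpa using h.symm
    rw [TotReal.secondFundamentalFormAt_eq_complexForm hJ hF hreal hf, hS, map_zero, map_zero]
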